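/- Let $\mathcal{O}$ be a complete discrete valuation ring whose residue field is algebraically closed of characteristic $2$ and whose field of fractions $K$ has characteristic zero. For a finite group $G$ let $\mathrm{Irr}(G)$ be the set of irreducible characters of $G$ over $K$, let $\mathrm{CF}(G,\mathcal{O})$ be the $\mathcal{O}$-module of the $\mathcal{O}$-valued functions on $G$ in the $K$-span $K\,\mathrm{Irr}(G)$, and let $\mathrm{CF}_{2'}(G,\mathcal{O})$ be the submodule of those that vanish at all elements of even order. A perfect self-isometry of $\mathcal{O}G$ is an isometry $I:\mathbb{Z}\,\mathrm{Irr}(G)\to\mathbb{Z}\,\mathrm{Irr}(G)$, with respect to the usual inner product, whose $K$-linear extension induces $\mathcal{O}$-module automorphisms of $\mathrm{CF}(G,\mathcal{O})$ and of $\mathrm{CF}_{2'}(G,\mathcal{O})$. Let $\omega\in\mathcal{O}$ be a primitive third root of unity, and let $\chi_1,\chi_2,\chi_3,\chi_4$ be the irreducible characters of $A_4$, with values at $(),\,(12)(34),\,(123),\,(132)$ equal to $(1,1,1,1)$, $(1,1,\omega,\omega^2)$, $(1,1,\omega^2,\omega)$, $(3,-1,0,0)$ respectively. Put $\delta_1=\delta_2=\delta_3=1$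 and $\delta_4=-1$. For $\sigma\in S_4$ and $\epsilon\in\{\pm1\}$ let $I_{\sigma,\epsilon}$ be the isometry of $\mathbb{Z}\,\mathrm{Irr}(A_4)$ with $I_{\sigma,\epsilon}(\chi_j)=\epsilon\,\delta_j\,\delta_{\sigma(j)}\,\chi_{\sigma(j)}$ for $1\le j\le 4$. **Theorem.** Let $P$ be a finite abelian $2$-group, and suppose that $K$ contains a primitive $|P\times A_4|$-th root of unity. Then every perfect self-isometry $I$ of $\mathcal{O}(P\times A_4)$ is of the form $(J,I_{\sigma,\epsilon})$, that is, $$I(\theta\otimes\chi)=J(\theta)\otimes I_{\sigma,\epsilon}(\chi)\qquad\text{for all }\theta\in\mathbb{Z}\,\mathrm{Irr}(P),\ \chi\in\mathbb{Z}\,\mathrm{Irr}(A_4),$$ where $\sigma\in S_4$, $\epsilon\in\{\pm1\}$, and $J$ is a perfect self-isometry of $\mathcal{O}P$ induced by an $\mathcal{O}$-algebra automorphism $\alpha$ of $\mathcal{O}P$, that is, $J(\theta)(g)=\theta(\alpha(g))$ for all $g\in P$ and $\theta\in\mathbb{Z}\,\mathrm{Irr}(P)$, where $\theta$ is extended $\mathcal{O}$-linearly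 to $\mathcal{O}P$. -/

import Mathlib

noncomputable section

namespace PerfIso

/-- The set `Irr(G)` of irreducible characters of `G` over `K`: the characters of the irreducible
finite-dimensional representations of `G` over `K`, as functions `G → K`. -/
def Irr (K G : Type*) [Field K] [Group G] : Set (G → K) :=
  {χ | ∃ (n : ℕ) (ρ : Representation K G (Fin n → K)), ρ.IsIrreducible ∧ χ = ρ.character}

/-- The group `ℤ Irr(G)` of virtual characters of `G` over `K`. -/
def VChar (K G : Type*) [Field K] [Group G] : Submodule ℤ (G → K) :=
  Submodule.span ℤ (Irr K G)

/-- The `K`-space `CF(G, 𝒪G, K) = K Irr(G)` of class functions spanned by `Irr(G)`. -/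
def CF (K G : Type*) [Field K] [Group G] : Submodule K (G → K) :=
  Submodule.span K (Irr K G)

theorem VChar_le_CF {K G : Type*} [Field K] [Group G] {φ : G → K} (h : φ ∈ VChar K G) :
    φ ∈ CF K G :=
  Submodule.span_subset_span ℤ K (Irr K G) h

/-- The inclusion `ℤ Irr(G) → K Irr(G)`. -/
def VChar.toCF {K G : Type*} [Field K] [Group G] (φ : VChar K G) : CF K G :=
  ⟨φ.1, VChar_le_CF φ.2⟩

/-- The `𝒪`-module `CF(G, 𝒪G, 𝒪)` of the elements of `CF(G, 𝒪G, K)` with values in `𝒪`. -/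
def CFInt (O K G : Type*) [CommRing O] [Field K] [Algebra O K] [Group G] :
    Submodule O (CF K G) where
  carrier := {φ | ∀ g : G, φ.1 g ∈ (algebraMap O K).range}
  add_mem' ha hb g := add_mem (ha g) (hb g)
  zero_mem' _ := zero_mem _
  smul_mem' c φ h g := by
    have : (c • φ).1 g = algebraMap O K c * φ.1 g := Algebra.smul_def c (φ.1 g)
    rw [this]
    exact mul_mem ⟨c, rfl⟩ (h g)

/-- The `𝒪`-module `CF_{p'}(G, 𝒪G, 𝒪)` of the elements of `CF(G, 𝒪G, 𝒪)` that vanish at all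
elements of `G` whose order is divisible by `p`. -/
def CFIntReg (O K G : Type*) [CommRing O] [Field K] [Algebra O K] [Group G] (p : ℕ) :
    Submodule O (CF K G) where
  carrier := {φ | φ ∈ CFInt O K G ∧ ∀ g : G, p ∣ orderOf g → φ.1 g = 0}
  add_mem' ha hb := ⟨add_mem ha.1 hb.1, fun g hg => by
    have := congrArg₂ (· + ·) (ha.2 g hg) (hb.2 g hg)
    simpa using this⟩
  zero_mem' := ⟨zero_mem _, fun _ _ => rfl⟩
  smul_mem' c φ h := ⟨Submodule.smul_mem _ c h.1, fun g hg => by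
    have : (c • φ).1 g = algebraMap O K c * φ.1 g := Algebra.smul_def c (φ.1 g)
    rw [this, h.2 g hg, mul_zero]⟩

/-- The usual inner product of class functions. -/
def charInner {K G : Type*} [Field K] [Group G] [Fintype G] (φ ψ : G → K) : K :=
  (Fintype.card G : K)⁻¹ * ∑ g, φ g * ψ g⁻¹

/-- `I : ℤ Irr(G) → ℤ Irr(H)` is a perfect isometry between `𝒪G` and `𝒪H`: it is an isometry, and
its `K`-linear extension `I_K : K Irr(G) → K Irr(H)` (which is unique, since `Irr(G)` spans
`K Irr(G)`) induces bijections between `CF(G, 𝒪G, 𝒪)` and `CF(H, 𝒪H, 𝒪)` and between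
`CF_{p'}(G, 𝒪G, 𝒪)` and `CF_{p'}(H, 𝒪H, 𝒪)`. -/
structure IsPerfectIsometry (O : Type*) {K G H : Type*} [CommRing O] [Field K] [Algebra O K]
    [Group G] [Group H] [Fintype G] [Fintype H] (p : ℕ) (I : VChar K G ≃ₗ[ℤ] VChar K H) :
    Prop where
  isometry : ∀ φ ψ : VChar K G,
    charInner (I φ : H → K) (I ψ : H → K) = charInner (φ : G → K) (ψ : G → K)
  extension : ∃ IK : CF K G ≃ₗ[K] CF K H,
    (∀ φ : VChar K G, IK (VChar.toCF φ) = VChar.toCF (I φ)) ∧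
    (∀ φ : CF K G, IK φ ∈ CFInt O K H ↔ φ ∈ CFInt O K G) ∧
    (∀ φ : CF K G, IK φ ∈ CFIntReg O K H p ↔ φ ∈ CFIntReg O K G p)

/-- The `𝒪`-linear extension to `𝒪G` of a function `χ : G → K`, evaluated at `a`. -/
def evalAt {O K G : Type*} [CommRing O] [Field K] [Algebra O K] (χ : G → K)
    (a : MonoidAlgebra O G) : K :=
  a.coeff.sum fun g r => algebraMap O K r * χ g

/-- `J : ℤ Irr(G) → ℤ Irr(G)` is induced by the `𝒪`-algebra automorphism `α` of `𝒪G`, that is, by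
the Morita auto-equivalence `M ↦ _αM` that twists the action of `𝒪G` on a module by `α`: the
character `χ` is sent to `χ ∘ α`. -/
def IsInducedBy {O K G : Type*} [CommRing O] [Field K] [Algebra O K] [Group G]
    (α : MonoidAlgebra O G ≃ₐ[O] MonoidAlgebra O G) (J : VChar K G ≃ₗ[ℤ] VChar K G) : Prop :=
  ∀ (χ : VChar K G) (g : G),
    (J χ : G → K) g = evalAt (χ : G → K) (α (MonoidAlgebra.of O G g))

/-- The alternating group `A₄`, as permutations of `{0, 1, 2, 3}`. -/
abbrev A4 : Type := alternatingGroup (Fin 4)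

/-- The 3-cycle `0 ↦ 1 ↦ 2 ↦ 0`. -/
def threeCycle : A4 :=
  ⟨Equiv.swap 0 1 * Equiv.swap 1 2, Equiv.Perm.mem_alternatingGroup.2 (by decide)⟩

/-- The number of the conjugacy class of `g ∈ A₄`: the identity, the three products of two disjoint
transpositions, the class of the chosen 3-cycle, the class of its inverse. -/
def a4Class (g : A4) : Fin 4 :=
  if g = 1 then 0 else if g ^ 2 = 1 then 1 else if IsConj threeCycle g then 2 else 3

/-- The irreducible characters `χ₁, …, χ₄` (here numbered from `0` to `3`) of `A₄`, by its character
table; `ω` is a primitive third root of unity. -/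
def a4Char {K : Type*} [Field K] (ω : K) (j : Fin 4) (g : A4) : K :=
  (!![1, 1, 1, 1;
      1, 1, ω, ω ^ 2;
      1, 1, ω ^ 2, ω;
      3, -1, 0, 0] : Matrix (Fin 4) (Fin 4) K) j (a4Class g)

/-- The signs `δ₁ = δ₂ = δ₃ = 1`, `δ₄ = -1`. -/
def a4Sign : Fin 4 → ℤ := ![1, 1, 1, -1]

/-- `I` is the isometry `I_{σ,ε}` of `ℤ Irr(A₄)`, which sends `χ_j` to
`ε δ_j δ_{σ(j)} χ_{σ(j)}` for all `j`. -/
def IsISigma {K : Type*} [Field K] (ω : K) (σ : Equiv.Perm (Fin 4)) (ε : ℤˣ)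
    (I : VChar K A4 ≃ₗ[ℤ] VChar K A4) : Prop :=
  ∀ j : Fin 4, ∃ h : a4Char ω j ∈ VChar K A4,
    (I ⟨a4Char ω j, h⟩ : A4 → K) = ((ε : ℤ) * a4Sign j * a4Sign (σ j)) • a4Char ω (σ j)

/-- The function `θ ⊗ χ` on `G × H`. -/
def outer {K G H : Type*} [Field K] (θ : G → K) (χ : H → K) : G × H → K :=
  fun x => θ x.1 * χ x.2

/-- `I = (J, I')`: the isometry `I` of `ℤ Irr(G × H)` sends `θ ⊗ χ` to `J(θ) ⊗ I'(χ)`. -/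
def IsPair {K G H : Type*} [Field K] [Group G] [Group H]
    (I : VChar K (G × H) ≃ₗ[ℤ] VChar K (G × H))
    (J : VChar K G ≃ₗ[ℤ] VChar K G) (I' : VChar K H ≃ₗ[ℤ] VChar K H) : Prop :=
  ∀ (θ : VChar K G) (χ : VChar K H),
    ∃ h : outer (θ : G → K) (χ : H → K) ∈ VChar K (G × H),
      (I ⟨outer (θ : G → K) (χ : H → K), h⟩ : G × H → K) =
        outer (J θ : G → K) (I' χ : H → K)

end PerfIso

end

/-!
Write `X` for the set of linear characters of `P`, put `η_j = δ_j χ_j`, and use the basis `θ ⊗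
η_j` (`θ ∈ X`, `1 ≤ j ≤ 4`) of `K Irr(P × A₄)`. In these signed coordinates everything that
matters about `A₄` is symmetric in the four indices. An isometry of `ℤ Irr(P × A₄)` is a signed
permutation `π` of the basis (`IsIrrSystem.exists_signed_perm`), and three facts determine its
shape.

* A combination `∑ b_{θ,j} θ ⊗ η_j` that vanishes on the elements of even order has coefficients
  that do not depend on `θ` and satisfy `∑ j, b_{θ,j} = 0` (`pair_coeff_const`,
  `pair_coeff_sum`), and the elements `∑ θ, θ ⊗ (η_i - η_j)` of `CF_{2'}` are of this form. As
  `π` respects such combinations, it acts on the index `j` by a permutation `σ` that does not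
  depend on `θ`, with one global sign `ε` (`exists_perm_of_sum_zero`, `exists_perm_snd`). So `π(θ
  ⊗ η_j) = ε τ_j(θ) ⊗ η_{σ(j)}`.
* The function `4⁻¹ ∑ j, θ ⊗ η_j` is integral, because `∑ j, η_j` only takes the values `0` and
  `4`. The coordinates of an integral function on `A₄` are congruent modulo `𝒪`
  (`sub_mem_range_of_sum_a4Eta`). Hence `τ_i(θ)` and `τ_j(θ)` are congruent modulo `4`, and as
  their values are roots of unity of `2`-power order, they are equal (`eq_of_congr_four`,
  `exists_perm_fst`). So `τ_j = τ` does not depend on `j`.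
* A function `B` on `P` is integral if and only if `B ⊗ η_j` is, since `η_j` takes the value `1` at
  the involutions. Hence `τ` preserves the lattice of the `𝒪`-valued functions on `P`
  (`integral_iff_of_perm`). This lattice is dual to `𝒪P`, and the transpose of `τ` is the
  automorphism `α` of `𝒪P`; it is multiplicative because `τ` permutes the homomorphisms `𝒪P → K`
  (`exists_algEquiv`). The same integrality makes `J = τ` a perfect isometry
  (`isPerfectIsometry_permIso`).

The classification of the irreducible characters of `P`, `A₄` and `P × A₄` over `K`, which need
not be algebraically closed, rests on the following: a list of orthonormal characters of
irreducible representations is complete as soon as only the zero class function is orthogonal to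
all of them, by the orthogonality of distinct irreducible characters (`IsIrrSystem.irr_eq`).
-/

namespace PerfIso

open Representation

/-! ### Irreducible representations and their characters -/

section Irr

variable {K G H : Type*} [Field K] [Group G] [Group H]

theorem isIrreducible_of_forall {V : Type*} [AddCommGroup V] [Module K V] [Nontrivial V]
    (ρ : Representation K G V)
    (h : ∀ W : Submodule K V, (∀ g, ∀ v ∈ W, ρ g v ∈ W) → W = ⊥ ∨ W = ⊤) :
    ρ.IsIrreducible := by
  have : Nontrivial (Subrepresentation ρ) :=
    ⟨⊥, ⊤, fun e => bot_ne_top (α := Submodule K V) (congrArg Subrepresentation.toSubmodule e)⟩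
  refine ⟨fun W => ?_⟩
  refine (h W.toSubmodule fun g v hv => W.apply_mem_toSubmodule g hv).imp ?_ ?_ <;>
  exact fun e => Subrepresentation.toSubmodule_injective e

theorem eq_bot_or_eq_top_of_isIrreducible {V : Type*} [AddCommGroup V] [Module K V]
    (ρ : Representation K G V) (hρ : ρ.IsIrreducible)
    (W : Submodule K V) (hW : ∀ g, ∀ v ∈ W, ρ g v ∈ W) : W = ⊥ ∨ W = ⊤ := by
  let W' : Subrepresentation ρ := ⟨W, fun g v hv => hW g v hv⟩
  exact (hρ.eq_bot_or_eq_top W').imp (congrArg Subrepresentation.toSubmodule)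
    (congrArg Subrepresentation.toSubmodule)

theorem nontrivial_of_isIrreducible {V : Type*} [AddCommGroup V] [Module K V]
    (ρ : Representation K G V) (hρ : ρ.IsIrreducible) : Nontrivial V := by
  by_contra hV
  rw [not_nontrivial_iff_subsingleton] at hV
  have := hρ.toNontrivial
  obtain ⟨a, b, hab⟩ := this
  exact hab (Subrepresentation.toSubmodule_injective (Subsingleton.elim _ _))

theorem linear_mem_irr (θ : G →* K) : (θ : G → K) ∈ Irr K G := by
  let ρ : Representation K G (Fin 1 → K) :=
    { toFun := fun g => θ g • LinearMap.id
      map_one' := by rw [map_one, one_smul]; rfl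
      map_mul' := fun x y => by
        refine LinearMap.ext fun v => ?_
        rw [map_mul, mul_smul]
        rfl }
  refine ⟨1, ρ, ?_, ?_⟩
  · apply isIrreducible_of_forall
    intro W _
    have : IsSimpleOrder (Submodule K (Fin 1 → K)) :=
      is_simple_module_of_finrank_eq_one (K := K) (by simp)
    exact eq_bot_or_eq_top W
  · ext g
    simp [character, ρ]

theorem outer_mem_irr (θ : G →* K) {χ : H → K} (hχ : χ ∈ Irr K H) :
    outer θ χ ∈ Irr K (G × H) := by
  obtain ⟨n, ρ, hρ, rfl⟩ := hχ
  let ρ' : Representation K (G × H) (Fin n → K) :=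
    { toFun := fun x => θ x.1 • ρ x.2
      map_one' := by simp
      map_mul' := fun x y => by simp [smul_smul, mul_comm] }
  refine ⟨n, ρ', ?_, ?_⟩
  · have := nontrivial_of_isIrreducible ρ hρ
    apply isIrreducible_of_forall
    intro W hW
    refine eq_bot_or_eq_top_of_isIrreducible ρ hρ W fun g v hv => ?_
    simpa [ρ'] using hW (1, g) v hv
  · ext x
    simp [character, ρ', outer]

theorem charInner_eq_zero_of_mem_irr [Fintype G] [CharZero K] {φ ψ : G → K} (hφ : φ ∈ Irr K G)
    (hψ : ψ ∈ Irr K G) (h : φ ≠ ψ) : charInner φ ψ = 0 := by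
  obtain ⟨n, ρ, hρ, rfl⟩ := hφ
  obtain ⟨m, ρ', hρ', rfl⟩ := hψ
  have hne : (Nat.card G : K) ≠ 0 := by exact_mod_cast Nat.card_pos.ne'
  let _ := invertibleOfNonzero hne
  have : IsEmpty (Representation.Equiv ρ' ρ) := ⟨fun e => h (char_iso e).symm⟩
  have key := card_inv_mul_sum_char_mul_char_eq_finrank ρ' ρ
  rw [Module.finrank_zero_of_subsingleton, Nat.cast_zero] at key
  rw [charInner, Fintype.card_eq_nat_card]
  exact key

theorem conj_eq_of_mem_irr {χ : G → K} (h : χ ∈ Irr K G) (x g : G) : χ (x * g * x⁻¹) = χ g := by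
  obtain ⟨n, ρ, -, rfl⟩ := h
  exact char_conj ρ g x

theorem ne_zero_of_mem_irr [CharZero K] {χ : G → K} (h : χ ∈ Irr K G) : χ ≠ 0 := by
  obtain ⟨n, ρ, hρ, rfl⟩ := h
  have := nontrivial_of_isIrreducible ρ hρ
  intro h
  have h1 := congrFun h 1
  rw [char_one] at h1
  exact Module.finrank_pos.ne' (Nat.cast_eq_zero.1 h1)

section Inner

variable [Fintype G] [Fintype H]

theorem charInner_sum_left {ι : Type*} (s : Finset ι) (f : ι → G → K) (ψ : G → K) :
    charInner (∑ i ∈ s, f i) ψ = ∑ i ∈ s, charInner (f i) ψ := by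
  simp only [charInner, Finset.sum_apply, Finset.sum_mul, ← Finset.mul_sum]
  rw [Finset.sum_comm]

theorem charInner_sum_right {ι : Type*} (s : Finset ι) (f : ι → G → K) (ψ : G → K) :
    charInner ψ (∑ i ∈ s, f i) = ∑ i ∈ s, charInner ψ (f i) := by
  simp only [charInner, Finset.sum_apply, Finset.mul_sum]
  rw [Finset.sum_comm]

theorem charInner_smul_left (c : K) (f ψ : G → K) : charInner (c • f) ψ = c * charInner f ψ := by
  simp only [charInner, Pi.smul_apply, smul_eq_mul, Finset.mul_sum]
  exact Finset.sum_congr rfl fun _ _ => by ring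

theorem charInner_smul_right (c : K) (f ψ : G → K) : charInner ψ (c • f) = c * charInner ψ f := by
  simp only [charInner, Pi.smul_apply, smul_eq_mul, Finset.mul_sum]
  exact Finset.sum_congr rfl fun _ _ => by ring

theorem charInner_sub_left (f f' ψ : G → K) :
    charInner (f - f') ψ = charInner f ψ - charInner f' ψ := by
  simp [charInner, sub_mul, mul_sub]

theorem charInner_outer (θ θ' : G → K) (χ χ' : H → K) :
    charInner (outer θ χ) (outer θ' χ') = charInner θ θ' * charInner χ χ' := by
  simp only [charInner, outer, Fintype.sum_prod_type, Fintype.card_prod, Nat.cast_mul, mul_inv,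
    Prod.fst_inv, Prod.snd_inv]
  rw [mul_mul_mul_comm, Finset.sum_mul_sum]
  congr 1
  exact Finset.sum_congr rfl fun _ _ => Finset.sum_congr rfl fun _ _ => by ring

end Inner

end Irr

/-! ### Complete lists of irreducible characters -/

/-- `e` lists the irreducible characters of `G` without repetition. Completeness is expressed by
the vanishing of the class functions that are orthogonal to all `e i`. -/
structure IsIrrSystem {K G ι : Type*} [Field K] [Group G] [Fintype G] (e : ι → G → K) : Prop where
  mem : ∀ i, e i ∈ Irr K G
  inner_self : ∀ i, charInner (e i) (e i) = 1
  inner_ne : ∀ i j, i ≠ j → charInner (e i) (e j) = 0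
  complete : ∀ f : G → K, (∀ x g, f (x * g * x⁻¹) = f g) → (∀ i, charInner f (e i) = 0) → f = 0

namespace IsIrrSystem

variable {K G H ι κ : Type*} [Field K] [Group G] [Group H] [Fintype G] [Fintype H]
  {e : ι → G → K}

theorem charInner_eq [DecidableEq ι] (he : IsIrrSystem e) (i j : ι) :
    charInner (e i) (e j) = if i = j then 1 else 0 := by
  split_ifs with h
  · rw [h, he.inner_self]
  · exact he.inner_ne i j h

theorem irr_eq [CharZero K] (he : IsIrrSystem e) : Irr K G = Set.range e := by
  apply Set.Subset.antisymm
  · intro χ hχ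
    by_contra h
    refine ne_zero_of_mem_irr hχ (he.complete χ (conj_eq_of_mem_irr hχ) fun i => ?_)
    exact charInner_eq_zero_of_mem_irr hχ (he.mem i) fun h' => h ⟨i, h'.symm⟩
  · rintro _ ⟨i, rfl⟩
    exact he.mem i

theorem prod {X : Type*} {θ : X → G →* K} (hθ : IsIrrSystem fun i => (θ i : G → K))
    {χ : κ → H → K} (hχ : IsIrrSystem χ) (hG : ∀ x g : G, x * g * x⁻¹ = g) :
    IsIrrSystem fun m : X × κ => outer (θ m.1 : G → K) (χ m.2) where
  mem m := outer_mem_irr _ (hχ.mem _)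
  inner_self m := by rw [charInner_outer, hθ.inner_self, hχ.inner_self, one_mul]
  inner_ne m n h := by
    rw [charInner_outer]
    by_cases h1 : m.1 = n.1
    · rw [hχ.inner_ne _ _ fun h2 => h (Prod.ext h1 h2), mul_zero]
    · rw [hθ.inner_ne _ _ h1, zero_mul]
  complete f hf h := by
    -- Separate the variables: the coefficient of `f (·, y)` at `θ i` is a class function of `y`.
    have h1 : ∀ i, (fun y => charInner (fun x => f (x, y)) (θ i)) = 0 := by
      intro i
      refine hχ.complete _ (fun x g => ?_) fun j => ?_
      · refine congrArg (fun F => charInner F (θ i : G → K)) (funext fun z => ?_)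
        simpa using hf (1, x) (z, g)
      · rw [← h (i, j)]
        simp only [charInner, outer, Fintype.sum_prod_type_right, Fintype.card_prod, Nat.cast_mul,
          mul_inv, Prod.fst_inv, Prod.snd_inv, Finset.mul_sum, Finset.sum_mul]
        exact Finset.sum_congr rfl fun _ _ => Finset.sum_congr rfl fun _ _ => by ring
    ext ⟨x, y⟩
    refine congrFun (hθ.complete (fun x => f (x, y)) (fun x g => by rw [hG]) fun i => ?_) x
    exact congrFun (h1 i) y

section Basis

variable [Fintype ι] (he : IsIrrSystem e)

include he in
theorem charInner_sum_smul [DecidableEq ι] (a : ι → K) (j : ι) :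
    charInner (∑ i, a i • e i) (e j) = a j := by
  simp [charInner_sum_left, charInner_smul_left, he.charInner_eq]

include he in
theorem linearIndependent : LinearIndependent K e := by
  classical
  rw [Fintype.linearIndependent_iff]
  intro a ha j
  rw [← he.charInner_sum_smul a j, ha]
  simp [charInner]

include he in
/-- The Fourier expansion of a class function. -/
theorem eq_sum (f : G → K) (hf : ∀ x g, f (x * g * x⁻¹) = f g) :
    f = ∑ i, charInner f (e i) • e i := by
  classical
  rw [← sub_eq_zero]
  refine he.complete _ (fun x g => ?_) fun j => ?_
  · simp only [Pi.sub_apply, Finset.sum_apply, Pi.smul_apply, hf,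
      fun i => conj_eq_of_mem_irr (he.mem i) x g]
  · rw [charInner_sub_left, he.charInner_sum_smul, sub_self]

variable [CharZero K]

/-- The basis `Irr(G)` of `ℤ Irr(G)`. -/
noncomputable def vBasis : Module.Basis ι ℤ (VChar K G) :=
  (Module.Basis.span (he.linearIndependent.restrict_scalars' ℤ)).map
    (LinearEquiv.ofEq _ _ (by rw [VChar, he.irr_eq]))

/-- The basis `Irr(G)` of `K Irr(G)`. -/
noncomputable def cBasis : Module.Basis ι K (CF K G) :=
  (Module.Basis.span he.linearIndependent).map
    (LinearEquiv.ofEq _ _ (by rw [CF, he.irr_eq]))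

@[simp]
theorem coe_vBasis (i : ι) : (he.vBasis i : G → K) = e i := by
  simp [vBasis, Module.Basis.span_apply]

@[simp]
theorem coe_cBasis (i : ι) : (he.cBasis i : G → K) = e i := by
  simp [cBasis, Module.Basis.span_apply]

theorem toCF_vBasis (i : ι) : VChar.toCF (he.vBasis i) = he.cBasis i :=
  Subtype.ext (by rw [coe_cBasis]; exact he.coe_vBasis i)

end Basis

end IsIrrSystem

/-! ### Linear characters of finite abelian groups -/

section Abelian

variable {K P : Type*} [Field K] [CommGroup P] [Fintype P]

/-- The linear characters of `P`, as functions. -/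
def linChar (θ : P →* Kˣ) (x : P) : K := θ x

theorem hasEnoughRootsOfUnity_exponent {n : ℕ} (hn : n ≠ 0) (hcard : Nat.card P ∣ n)
    (hK : ∃ ζ : K, IsPrimitiveRoot ζ n) : HasEnoughRootsOfUnity K (Monoid.exponent P) := by
  obtain ⟨ζ, hζ⟩ := hK
  obtain ⟨m, hm⟩ := Group.exponent_dvd_nat_card.trans hcard
  have : NeZero (Monoid.exponent P) := ⟨Monoid.exponent_ne_zero_of_finite⟩
  exact ⟨⟨ζ ^ m, hζ.pow (Nat.pos_of_ne_zero hn) (by rw [hm, mul_comm])⟩, inferInstance⟩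

theorem isIrrSystem_linChar [CharZero K] [HasEnoughRootsOfUnity K (Monoid.exponent P)] :
    IsIrrSystem (linChar (K := K) (P := P)) := by
  have hP : (Fintype.card P : K) ≠ 0 := Nat.cast_ne_zero.2 Fintype.card_ne_zero
  have hfin : Finite (P →* Kˣ) := Finite.of_equiv P
    (CommGroup.monoidHom_mulEquiv_of_hasEnoughRootsOfUnity P K).some.symm.toEquiv
  have hft := Fintype.ofFinite (P →* Kˣ)
  have hcard : (Fintype.card (P →* Kˣ) : K) = Fintype.card P := by
    rw [Fintype.card_congr (CommGroup.monoidHom_mulEquiv_of_hasEnoughRootsOfUnity P K).some.toEquiv]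
  refine ⟨fun θ => linear_mem_irr ((Units.coeHom K).comp θ), fun θ => ?_, fun θ θ' h => ?_,
    fun f _ hf => ?_⟩
  · simp [charInner, linChar, hP]
  · have hz : ∃ z, (θ z : K) ≠ θ' z := by
      by_contra! hall
      exact h (MonoidHom.ext fun z => Units.ext (hall z))
    obtain ⟨z, hz⟩ := hz
    have hshift : ∑ g, linChar θ g * linChar θ' g⁻¹
        = (θ z * (θ' z)⁻¹ : Kˣ) * ∑ g, linChar θ g * linChar θ' g⁻¹ := by
      rw [Finset.mul_sum, ← Equiv.sum_comp (Equiv.mulLeft z)]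
      refine Finset.sum_congr rfl fun g _ => ?_
      simp only [linChar, Equiv.coe_mulLeft, map_mul, map_inv, Units.val_mul,
        Units.val_inv_eq_inv_val, mul_inv]
      ring
    rw [charInner]
    refine mul_eq_zero_of_right _ (by_contra fun hS => hz ?_)
    have h1 := (mul_eq_right₀ hS).1 hshift.symm
    rw [← mul_inv_eq_one₀ (Units.ne_zero _)]
    simpa using h1
  · have hcol : ∀ g : P, g ≠ 1 → ∑ θ : P →* Kˣ, (θ g : K) = 0 := by
      intro g hg
      obtain ⟨θ₀, h₀⟩ := CommGroup.exists_apply_ne_one_of_hasEnoughRootsOfUnity P K hg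
      have hshift : ∑ θ : P →* Kˣ, (θ g : K) = θ₀ g * ∑ θ : P →* Kˣ, (θ g : K) := by
        rw [Finset.mul_sum, ← Equiv.sum_comp (Equiv.mulLeft θ₀)]
        simp
      by_contra hS
      exact h₀ (Units.ext ((mul_eq_right₀ hS).1 hshift.symm))
    ext x
    have hinv : ∑ θ : P →* Kˣ, (θ x : K) * charInner f (linChar θ) = f x := by
      simp only [charInner, Finset.mul_sum]
      rw [Finset.sum_comm, Finset.sum_eq_single x]
      · have : ∀ θ : P →* Kˣ, (θ x : K) * ((Fintype.card P : K)⁻¹ * (f x * linChar θ x⁻¹))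
            = (Fintype.card P : K)⁻¹ * f x := by
          intro θ
          simp only [linChar, map_inv, Units.val_inv_eq_inv_val]
          field_simp
        simp [this, hcard, hP]
      · intro g _ hg
        have := hcol (x * g⁻¹) (fun h => hg (mul_inv_eq_one.1 h).symm)
        calc _ = (Fintype.card P : K)⁻¹ * f g * ∑ θ : P →* Kˣ, (θ (x * g⁻¹) : K) := by
              rw [Finset.mul_sum]
              refine Finset.sum_congr rfl fun θ _ => ?_
              simp only [linChar, map_mul, map_inv, Units.val_mul]
              ring
          _ = 0 := by rw [this, mul_zero]
      · simp
    rw [← hinv]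
    simp [hf]

end Abelian

/-! ### The character table of the alternating group of degree four -/

section A4

/-- The exponent of `ω` in the value at `g` of the second irreducible character of `A₄`. -/
def a4Exp (g : A4) : ZMod 3 := ![0, 0, 1, 2] (a4Class g)

theorem a4Exp_mul : ∀ g h : A4, a4Exp (g * h) = a4Exp g + a4Exp h := by
  decide +kernel

theorem a4Class_inv : ∀ g : A4, a4Class g⁻¹ = ![0, 1, 3, 2] (a4Class g) := by
  decide +kernel

theorem card_a4Class : ∀ k : Fin 4,
    (Finset.univ.filter fun g : A4 => a4Class g = k).card = ![1, 3, 4, 4] k := by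
  decide +kernel

theorem isConj_of_a4Class_eq : ∀ g h : A4, a4Class g = a4Class h → IsConj g h := by
  decide +kernel

/-- Three vectors of `±1`s that `A₄` permutes up to signs. -/
def a4Vec (i : Fin 3) (k : Fin 4) : ℤ :=
  (!![1, 1, -1, -1; 1, -1, 1, -1; 1, -1, -1, 1] : Matrix (Fin 3) (Fin 4) ℤ) i k

/-- The matrices of the irreducible representation of `A₄` of degree `3`. They are monomial: up to
sign, `A₄` permutes the vectors `a4Vec i`, and `∑ k, a4Vec i (g k) * a4Vec j k` is `0` or `±4`, so
the integer division is exact. -/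
def a4Mat (g : A4) : Matrix (Fin 3) (Fin 3) ℤ :=
  Matrix.of fun i j => (∑ k, a4Vec i (g.1 k) * a4Vec j k) / 4

theorem a4Mat_one : a4Mat 1 = 1 := by
  decide +kernel

theorem a4Mat_mul : ∀ g h : A4, a4Mat (g * h) = a4Mat g * a4Mat h := by
  decide +kernel

theorem trace_a4Mat : ∀ g : A4, (a4Mat g).trace = ![3, -1, 0, 0] (a4Class g) := by
  decide +kernel

/-- For each `i` some element of `A₄` acts as `1` on the `i`-th coordinate and as `-1` on the
others. -/
theorem exists_a4Mat_add_one : ∀ i : Fin 3, ∃ g : A4,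
    a4Mat g + 1 = Matrix.of fun a b => if a = i ∧ b = i then 2 else 0 := by
  decide +kernel

theorem exists_a4Mat_col : ∀ i j : Fin 3, ∃ g : A4,
    ∀ a, a4Mat g a i = if a = j then 1 else 0 := by
  decide +kernel

variable {K : Type*} [Field K]

theorem sum_a4Class (F : Fin 4 → K) :
    ∑ g : A4, F (a4Class g) = F 0 + 3 * F 1 + 4 * F 2 + 4 * F 3 := by
  rw [← Finset.sum_fiberwise (s := Finset.univ) (g := a4Class)]
  have : ∀ k : Fin 4, ∑ g : A4 with a4Class g = k, F (a4Class g)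
      = (![1, 3, 4, 4] k : ℕ) * F k := by
    intro k
    rw [← card_a4Class, ← nsmul_eq_mul]
    exact Finset.sum_eq_card_nsmul fun g hg => by rw [(Finset.mem_filter.1 hg).2]
  simp [this, Fin.sum_univ_four]

theorem card_A4 : Fintype.card A4 = 12 := by
  decide +kernel

/-- The representation of `A₄` with matrices `a4Mat`. -/
def a4Rep (K : Type*) [Field K] : Representation K A4 (Fin 3 → K) where
  toFun g := Matrix.toLin' ((a4Mat g).map (Int.castRingHom K))
  map_one' := by
    rw [a4Mat_one]
    simp [Matrix.map_one, Module.End.one_eq_id]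
  map_mul' g h := by
    rw [a4Mat_mul, Matrix.map_mul, Matrix.toLin'_mul, Module.End.mul_eq_comp]

theorem a4Rep_apply (g : A4) (v : Fin 3 → K) (a : Fin 3) :
    a4Rep K g v a = ∑ b, (a4Mat g a b : K) * v b := by
  simp [a4Rep, Matrix.toLin'_apply, Matrix.mulVec, dotProduct]

theorem isIrreducible_a4Rep [CharZero K] : (a4Rep K).IsIrreducible := by
  apply isIrreducible_of_forall
  intro W hW
  rw [or_iff_not_imp_left, Submodule.eq_bot_iff]
  intro h
  push Not at h
  obtain ⟨v, hv, hv0⟩ := h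
  obtain ⟨i, hi⟩ := Function.ne_iff.1 hv0
  -- A multiple of the `i`-th unit vector lies in `W`, hence so do its images under `A₄`.
  obtain ⟨g, hg⟩ := exists_a4Mat_add_one i
  have h1 : a4Rep K g v + v = (2 * v i) • Pi.single i 1 := by
    ext a
    have h2 : ∀ b, (a4Mat g a b : K) * v b
        = (if a = i ∧ b = i then 2 else 0) * v b - (if a = b then 1 else 0) * v b := by
      intro b
      have := congrFun (congrFun hg a) b
      rw [Matrix.add_apply, ← eq_sub_iff_add_eq] at this
      rw [this, Matrix.one_apply, ← sub_mul]
      simp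
    rw [Pi.add_apply, a4Rep_apply]
    simp only [h2, Finset.sum_sub_distrib]
    by_cases ha : a = i
    · subst ha; simp
    · simp [ha]
  have hi2 : (2 * v i : K) ≠ 0 := mul_ne_zero two_ne_zero hi
  have h3 : (Pi.single i 1 : Fin 3 → K) ∈ W := by
    rw [← W.smul_mem_iff hi2, ← h1]
    exact W.add_mem (hW g v hv) hv
  have h4 : ∀ j, (Pi.single j 1 : Fin 3 → K) ∈ W := by
    intro j
    obtain ⟨g, hg⟩ := exists_a4Mat_col i j
    convert! hW g _ h3 using 1
    ext a
    rw [a4Rep_apply]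
    simp [Pi.single_apply, hg]
  rw [eq_top_iff]
  intro w _
  rw [pi_eq_sum_univ' w]
  exact W.sum_mem fun j _ => W.smul_mem _ (by convert! h4 j)

variable {ω : K}

theorem a4Char_three_mem_irr [CharZero K] (ω : K) : a4Char ω 3 ∈ Irr K A4 := by
  refine ⟨3, a4Rep K, isIrreducible_a4Rep, ?_⟩
  ext g
  have h : (a4Rep K).character g = ((a4Mat g).trace : K) := by
    simp [character, a4Rep, Matrix.trace]
  rw [h, trace_a4Mat, a4Char]
  generalize a4Class g = k
  fin_cases k <;> simp

/-- The linear character of `A₄` that takes the value `z` at the chosen 3-cycle. -/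
def a4Lin (z : K) (hz : z ^ 3 = 1) : A4 →* K where
  toFun g := z ^ (a4Exp g).val
  map_one' := by
    have : a4Exp 1 = 0 := by simpa using a4Exp_mul 1 1
    simp [this]
  map_mul' g h := by
    rw [a4Exp_mul, ZMod.val_add, ← pow_add, ← pow_eq_pow_mod _ hz]

theorem a4Lin_apply (z : K) (hz : z ^ 3 = 1) (g : A4) :
    a4Lin z hz g = ![1, 1, z, z ^ 2] (a4Class g) := by
  change z ^ (![0, 0, 1, 2] (a4Class g) : ZMod 3).val = _
  generalize a4Class g = k
  fin_cases k
  · simp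
  · simp
  · exact pow_one z
  · rfl

theorem one_add_omega (hω : IsPrimitiveRoot ω 3) : 1 + ω + ω ^ 2 = 0 := by
  simpa [Finset.sum_range_succ] using hω.geom_sum_eq_zero (by norm_num)

theorem a4Char_mem_irr [CharZero K] (hω : IsPrimitiveRoot ω 3) (j : Fin 4) :
    a4Char ω j ∈ Irr K A4 := by
  have h3 := hω.pow_eq_one
  have h : ∀ (z : K) (hz : z ^ 3 = 1) (j : Fin 4),
      (∀ k, ![1, 1, z, z ^ 2] k = (!![1, 1, 1, 1; 1, 1, ω, ω ^ 2; 1, 1, ω ^ 2, ω; 3, -1, 0, 0] :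
        Matrix (Fin 4) (Fin 4) K) j k) → a4Char ω j ∈ Irr K A4 := by
    intro z hz j hj
    convert linear_mem_irr (a4Lin z hz) using 1
    ext g
    rw [a4Lin_apply, a4Char, hj]
  fin_cases j
  · exact h 1 (one_pow 3) 0 fun k => by fin_cases k <;> simp
  · exact h ω h3 1 fun k => by fin_cases k <;> simp
  · refine h (ω ^ 2) (by linear_combination (ω ^ 3 + 1) * h3) 2 fun k => ?_
    fin_cases k <;> simp
    linear_combination ω * h3
  · exact a4Char_three_mem_irr ω

theorem a4Char_eq (ω : K) (j : Fin 4) (g : A4) :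
    a4Char ω j g = ![![1, 1, 1, 1], ![1, 1, ω, ω ^ 2], ![1, 1, ω ^ 2, ω], ![3, -1, 0, 0]] j
      (a4Class g) := rfl

theorem charInner_a4 (F : Fin 4 → K) (j : Fin 4) :
    charInner (fun g => F (a4Class g)) (a4Char ω j)
      = 12⁻¹ * (F 0 * ![1, 1, 1, 3] j + 3 * (F 1 * ![1, 1, 1, -1] j)
        + 4 * (F 2 * ![1, ω ^ 2, ω, 0] j) + 4 * (F 3 * ![1, ω, ω ^ 2, 0] j)) := by
  rw [charInner, card_A4]
  simp only [a4Char_eq, a4Class_inv]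
  rw [sum_a4Class fun k => F k * ![![1, 1, 1, 1], ![1, 1, ω, ω ^ 2], ![1, 1, ω ^ 2, ω],
    ![3, -1, 0, 0]] j (![0, 1, 3, 2] k)]
  fin_cases j <;> simp

theorem isIrrSystem_a4Char [CharZero K] (hω : IsPrimitiveRoot ω 3) :
    IsIrrSystem (a4Char ω) := by
  have h0 := one_add_omega hω
  have h3 := hω.pow_eq_one
  have hinner : ∀ i j, charInner (a4Char ω i) (a4Char ω j) = if i = j then 1 else 0 := by
    intro i j
    refine (charInner_a4 _ j).trans ?_
    fin_cases i <;> fin_cases j <;> simp <;> grind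
  refine ⟨a4Char_mem_irr hω, fun i => by simp [hinner], fun i j h => by simp [hinner, h],
    fun f hf h => ?_⟩
  -- A class function factors through the number of the class.
  have hsurj : Function.Surjective a4Class := by
    have : ∀ k, ∃ g, a4Class g = k := by decide +kernel
    exact this
  obtain ⟨F, rfl⟩ : ∃ F : Fin 4 → K, f = fun g => F (a4Class g) := by
    refine ⟨fun k => f (Function.surjInv hsurj k), funext fun g => ?_⟩
    obtain ⟨x, hx⟩ := isConj_iff.1 (isConj_of_a4Class_eq g _
      (Function.surjInv_eq hsurj (a4Class g)).symm)
    exact (hf x g).symm.trans (congrArg f hx)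
  simp only [charInner_a4, mul_eq_zero, inv_eq_zero, OfNat.ofNat_ne_zero, false_or] at h
  have e0 := h 0
  have e1 := h 1
  have e2 := h 2
  have e3 := h 3
  simp only [Matrix.cons_val] at e0 e1 e2 e3
  ext g
  generalize a4Class g = k
  have hF : F 0 = 0 ∧ F 1 = 0 ∧ F 2 = 0 ∧ F 3 = 0 := by
    have f2 : 12 * F 2 = 0 := by
      linear_combination e0 + ω * e1 + ω ^ 2 * e2 - (F 0 + 3 * F 1 + 4 * F 3) * h0
        - (8 * F 2 + 4 * F 3 * ω) * h3
    have f3 : 12 * F 3 = 0 := by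
      linear_combination e0 + ω ^ 2 * e1 + ω * e2 - (F 0 + 3 * F 1 + 4 * F 2) * h0
        - (8 * F 3 + 4 * F 2 * ω) * h3
    have f0 : 12 * F 0 = 0 := by
      linear_combination e0 + e1 + e2 + 3 * e3 - 4 * (F 2 + F 3) * h0
    have f1 : 12 * F 1 = 0 := by
      linear_combination e0 + e1 + e2 - e3 - 4 * (F 2 + F 3) * h0
    simpa using And.intro f0 (And.intro f1 (And.intro f2 f3))
  fin_cases k <;> simp [hF]

end A4

/-! ### Isometries as signed permutations -/

section SignedPerm

variable {K G ι : Type*} [Field K] [CharZero K] [Group G] [Fintype G] [Fintype ι] {e : ι → G → K}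

namespace IsIrrSystem

variable (he : IsIrrSystem e)

theorem coe_eq_sum_repr (φ : VChar K G) :
    (φ : G → K) = ∑ i, (he.vBasis.repr φ i : K) • e i := by
  conv_lhs => rw [← he.vBasis.sum_repr φ]
  rw [Submodule.coe_sum]
  refine Finset.sum_congr rfl fun i _ => ?_
  rw [Submodule.coe_smul, coe_vBasis, Int.cast_smul_eq_zsmul]

theorem charInner_eq_sum_repr (φ ψ : VChar K G) :
    charInner (φ : G → K) (ψ : G → K)
      = ((∑ i, he.vBasis.repr φ i * he.vBasis.repr ψ i : ℤ) : K) := by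
  classical
  rw [he.coe_eq_sum_repr φ, he.coe_eq_sum_repr ψ, charInner_sum_right]
  push_cast
  refine Finset.sum_congr rfl fun i _ => ?_
  rw [charInner_smul_right, he.charInner_sum_smul, mul_comm]

/-- An isometry of `ℤ Irr(G)` permutes the irreducible characters up to signs. -/
theorem exists_signed_perm (I : VChar K G ≃ₗ[ℤ] VChar K G)
    (hI : ∀ φ ψ : VChar K G,
      charInner (I φ : G → K) (I ψ : G → K) = charInner (φ : G → K) (ψ : G → K)) :
    ∃ (π : Equiv.Perm ι) (s : ι → ℤˣ), ∀ i, I (he.vBasis i) = (s i : ℤ) • he.vBasis (π i) := by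
  classical
  set A : ι → ι → ℤ := fun i j => he.vBasis.repr (I (he.vBasis i)) j with hA
  have hAA : ∀ i i', ∑ j, A i j * A i' j = if i = i' then 1 else 0 := by
    intro i i'
    have h := hI (he.vBasis i) (he.vBasis i')
    rw [he.charInner_eq_sum_repr, coe_vBasis, coe_vBasis, he.charInner_eq] at h
    exact_mod_cast h
  -- The rows of `A` are integral vectors of norm `1`.
  have hrow : ∀ i, ∃ j, IsUnit (A i j) ∧ ∀ k, k ≠ j → A i k = 0 := by
    intro i
    have h1 : ∑ j, A i j * A i j = 1 := by rw [hAA, if_pos rfl]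
    obtain ⟨j, -, hj⟩ := Finset.exists_ne_zero_of_sum_ne_zero (h1.trans_ne one_ne_zero)
    have hj' : 1 ≤ A i j * A i j :=
      lt_of_le_of_ne (mul_self_nonneg _) hj.symm
    rw [← Finset.add_sum_erase _ _ (Finset.mem_univ j)] at h1
    have hnn : ∀ k ∈ Finset.univ.erase j, 0 ≤ A i k * A i k := fun k _ => mul_self_nonneg _
    have h2 := Finset.sum_nonneg hnn
    refine ⟨j, IsUnit.of_mul_eq_one (A i j) (by omega), fun k hk => ?_⟩
    have h3 := (Finset.sum_eq_zero_iff_of_nonneg hnn).1 (by omega) k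
      (Finset.mem_erase.2 ⟨hk, Finset.mem_univ k⟩)
    exact mul_self_eq_zero.1 h3
  choose π hu hz using hrow
  have hπ : Function.Injective π := by
    intro i i' h
    by_contra hne
    have h0 := hAA i i'
    rw [if_neg hne, Finset.sum_eq_single (π i) (fun k _ hk => by rw [hz i k hk, zero_mul])
      (by simp)] at h0
    refine ((hu i).mul ?_).ne_zero h0
    rw [h]
    exact hu i'
  refine ⟨Equiv.ofBijective π (Finite.injective_iff_bijective.1 hπ), fun i => (hu i).unit,
    fun i => ?_⟩
  rw [← he.vBasis.sum_repr (I (he.vBasis i)), Finset.sum_eq_single (π i)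
    (fun k _ hk => by rw [show he.vBasis.repr (I (he.vBasis i)) k = 0 from hz i k hk, zero_smul])
    (by simp)]
  rfl

end IsIrrSystem

end SignedPerm

section Combinatorics

/-- The combinatorial part of the argument: `q` and `u` describe the inverse of a signed permutation
of `X × Fin 4` by the second component and the sign of the image. If this inverse signed permutation
respects the vectors of coordinate sum zero that are constant along `X`, then `q` is a permutation
of the second factor, and the signs are all equal. -/
theorem exists_perm_of_sum_zero {X : Type*} [Nonempty X] (q : X × Fin 4 → Fin 4)
    (hq : Function.Surjective q) (u : X × Fin 4 → ℤˣ)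
    (hconst : ∀ i j : Fin 4, i ≠ j → ∀ (θ θ' : X) (k : Fin 4),
      ((if q (θ, k) = i then 1 else 0) - (if q (θ, k) = j then 1 else 0)) * (u (θ, k) : ℤ)
        = ((if q (θ', k) = i then 1 else 0) - (if q (θ', k) = j then 1 else 0)) * (u (θ', k) : ℤ))
    (hsum : ∀ i j : Fin 4, i ≠ j → ∀ θ : X,
      ∑ k, ((if q (θ, k) = i then 1 else 0) - (if q (θ, k) = j then 1 else 0)) * (u (θ, k) : ℤ)
        = 0) :
    ∃ (κ : Equiv.Perm (Fin 4)) (ε : ℤˣ), ∀ n, q n = κ n.2 ∧ u n = ε := by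
  have key : ∀ (θ θ' : X) (k : Fin 4), q (θ, k) = q (θ', k) ∧ u (θ, k) = u (θ', k) := by
    intro θ θ' k
    obtain ⟨p, hp, hp'⟩ : ∃ p, p ≠ q (θ, k) ∧ p ≠ q (θ', k) := by
      have : ∀ a b : Fin 4, ∃ p, p ≠ a ∧ p ≠ b := by decide
      exact this _ _
    have h := hconst (q (θ, k)) p hp.symm θ θ' k
    rw [if_pos rfl, if_neg hp.symm, if_neg hp'.symm, sub_zero, sub_zero, one_mul] at h
    split_ifs at h with h1
    · exact ⟨h1.symm, Units.ext (by simpa using h)⟩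
    · simp at h
  obtain ⟨θ₀⟩ := ‹Nonempty X›
  have hκ : Function.Surjective fun k => q (θ₀, k) := by
    intro i
    obtain ⟨⟨θ, k⟩, h⟩ := hq i
    exact ⟨k, (key θ₀ θ k).1.trans h⟩
  let κ : Equiv.Perm (Fin 4) := Equiv.ofBijective _ (Finite.surjective_iff_bijective.1 hκ)
  have hκ' : ∀ k, q (θ₀, k) = κ k := fun _ => rfl
  have hu : ∀ k l, u (θ₀, k) = u (θ₀, l) := by
    intro k l
    by_cases hkl : k = l
    · rw [hkl]
    have h := hsum (κ k) (κ l) (fun h => hkl (κ.injective h)) θ₀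
    simp only [hκ', κ.injective.eq_iff, sub_mul, Finset.sum_sub_distrib, ite_mul, one_mul, zero_mul,
      Finset.sum_ite_eq', Finset.mem_univ, if_true] at h
    exact Units.ext (sub_eq_zero.1 h)
  exact ⟨κ, u (θ₀, 0), fun n => ⟨(key n.1 θ₀ n.2).1, (key n.1 θ₀ n.2).2.trans (hu n.2 0)⟩⟩

end Combinatorics

/-! ### Integrality and roots of unity -/

section Arithmetic

variable {O K : Type*} [CommRing O] [IsDomain O] [IsDiscreteValuationRing O]
  [CharP (IsLocalRing.ResidueField O) 2] [Field K] [CharZero K] [Algebra O K] [IsFractionRing O K]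

variable (O) in
theorem not_isUnit_two : ¬ IsUnit (2 : O) := by
  intro h
  have h1 := h.map (IsLocalRing.residue O)
  rw [map_ofNat, CharTwo.two_eq_zero] at h1
  exact not_isUnit_zero h1

variable (O) in
theorem isUnit_three : IsUnit (3 : O) := by
  by_contra h
  have h2 := (IsLocalRing.mem_maximalIdeal _).2 (not_isUnit_two O)
  have h3 := (IsLocalRing.mem_maximalIdeal (3 : O)).2 h
  have h1 := Ideal.sub_mem _ h3 h2
  rw [show (3 - 2 : O) = 1 by norm_num] at h1
  exact (Ideal.ne_top_iff_one _).1 (IsLocalRing.maximalIdeal.isMaximal O).ne_top h1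

variable (O K) in
theorem half_not_mem_range : (2⁻¹ : K) ∉ (algebraMap O K).range := by
  rintro ⟨a, ha⟩
  refine not_isUnit_two O (IsUnit.of_mul_eq_one a (IsFractionRing.injective O K ?_))
  rw [map_mul, ha, map_ofNat, map_one]
  norm_num

omit [CharZero K] [IsFractionRing O K] in
theorem mem_range_of_three_mul_mem {a : K} (h : 3 * a ∈ (algebraMap O K).range) :
    a ∈ (algebraMap O K).range := by
  obtain ⟨b, hb⟩ := h
  obtain ⟨c, hc⟩ := isUnit_iff_exists_inv.1 (isUnit_three O)
  refine ⟨c * b, ?_⟩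
  have hc' := congrArg (algebraMap O K) hc
  rw [map_mul, map_ofNat, map_one] at hc'
  rw [map_mul, hb]
  linear_combination a * hc'

omit [CharP (IsLocalRing.ResidueField O) 2] [CharZero K] in
theorem mem_range_of_pow_eq_one {z : K} {n : ℕ} (hn : n ≠ 0) (hz : z ^ n = 1) :
    z ∈ (algebraMap O K).range :=
  IsIntegrallyClosed.isIntegral_iff.1 (IsIntegral.of_pow (Nat.pos_of_ne_zero hn)
    (hz ▸ isIntegral_one))

variable (O) in
/-- A root of unity of `2`-power order that is congruent to `1` modulo `4` is `1`: otherwise some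
power of it would be `-1`. -/
theorem eq_one_of_congr_four {n : ℕ} {z : K} (hz : z ^ 2 ^ n = 1)
    (h4 : (z - 1) / 4 ∈ (algebraMap O K).range) : z = 1 := by
  induction n with
  | zero => simpa using hz
  | succ n ih =>
    have hzO : z ∈ (algebraMap O K).range :=
      mem_range_of_pow_eq_one (n := 2 ^ (n + 1)) (by positivity) hz
    rw [pow_succ, pow_mul, sq_eq_one_iff] at hz
    refine hz.elim ih fun h => absurd ?_ (half_not_mem_range O K)
    have h1 := mul_mem (sum_mem fun i (_ : i ∈ Finset.range (2 ^ n)) => pow_mem hzO i) h4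
    rw [← mul_div_assoc, geom_sum_mul, h] at h1
    convert! neg_mem h1 using 1
    norm_num

variable (O) in
theorem eq_of_congr_four {n : ℕ} {z w : K} (hz : z ^ 2 ^ n = 1) (hw : w ^ 2 ^ n = 1)
    (h4 : z / 4 - w / 4 ∈ (algebraMap O K).range) : z = w := by
  have hw0 : w ≠ 0 := by
    rintro rfl
    simp at hw
  have hwi : w⁻¹ ∈ (algebraMap O K).range :=
    mem_range_of_pow_eq_one (n := 2 ^ n) (by positivity) (by rw [inv_pow, hw, inv_one])
  rw [← div_eq_one_iff_eq hw0]
  refine eq_one_of_congr_four O (n := n) (by rw [div_pow, hz, hw, div_one]) ?_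
  convert! mul_mem hwi h4 using 1
  field_simp

end Arithmetic

/-! ### The signed character table of the alternating group -/

section Eta

variable {K : Type*} [Field K]

/-- The signed irreducible character `δ_j χ_j` of `A₄`. -/
def a4Eta (ω : K) (j : Fin 4) (y : A4) : K := (a4Sign j : K) * a4Char ω j y

theorem a4Eta_eq (ω : K) (j : Fin 4) (y : A4) :
    a4Eta ω j y = ![![1, 1, 1, 1], ![1, 1, ω, ω ^ 2], ![1, 1, ω ^ 2, ω], ![-3, 1, 0, 0]] j
      (a4Class y) := by
  rw [a4Eta, a4Char_eq]
  generalize a4Class y = k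
  fin_cases j <;> fin_cases k <;> simp [a4Sign]

theorem exists_a4Class_eq : ∀ k, ∃ y, a4Class y = k := by
  decide +kernel

theorem a4Eta_of_class_one (ω : K) (j : Fin 4) {y : A4} (hy : a4Class y = 1) :
    a4Eta ω j y = 1 := by
  rw [a4Eta_eq, hy]
  fin_cases j <;> simp

theorem two_dvd_orderOf_iff_a4Class : ∀ y : A4, 2 ∣ orderOf y ↔ a4Class y = 1 := by
  have h : ∀ y : A4, (a4Class y = 1 → y ^ 2 = 1 ∧ y ≠ 1) ∧ (a4Class y ≠ 1 → y ^ 3 = 1) := by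
    decide +kernel
  intro y
  constructor
  · intro h2
    by_contra hy
    have := h2.trans (orderOf_dvd_of_pow_eq_one ((h y).2 hy))
    omega
  · intro hy
    rw [orderOf_eq_prime ((h y).1 hy).1 ((h y).1 hy).2]

theorem sum_a4Eta {ω : K} (hω : 1 + ω + ω ^ 2 = 0) (y : A4) :
    ∑ j, a4Eta ω j y = if a4Class y = 1 then 4 else 0 := by
  simp only [a4Eta_eq]
  generalize a4Class y = k
  fin_cases k <;> simp [Fin.sum_univ_four] 
  all_goals first | ring1 | linear_combination hω

variable {O : Type*} [CommRing O] [Algebra O K]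

theorem a4Eta_mem_range {ω : K} (hω : ω ∈ (algebraMap O K).range) (j : Fin 4) (y : A4) :
    a4Eta ω j y ∈ (algebraMap O K).range := by
  rw [a4Eta_eq]
  generalize a4Class y = k
  have h1 := one_mem (algebraMap O K).range
  have h2 := pow_mem hω 2
  have h3 : (-3 : K) ∈ (algebraMap O K).range := ⟨-3, by rw [map_neg, map_ofNat]⟩
  have h0 := zero_mem (algebraMap O K).range
  fin_cases j <;> fin_cases k <;> assumption

variable [IsDomain O] [IsDiscreteValuationRing O] [CharP (IsLocalRing.ResidueField O) 2]

/-- The coordinates in the signed basis `δ_j χ_j` of an integral class function of `A₄` are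
congruent to each other. This congruence is invariant under all permutations of the coordinates. -/
theorem sub_mem_range_of_sum_a4Eta {ω : K} (hω : IsPrimitiveRoot ω 3)
    (hωO : ω ∈ (algebraMap O K).range) (b : Fin 4 → K)
    (hb : ∀ y, ∑ k, b k * a4Eta ω k y ∈ (algebraMap O K).range) (k l : Fin 4) :
    b k - b l ∈ (algebraMap O K).range := by
  have h0 := one_add_omega hω
  have h3 := hω.pow_eq_one
  have hv : ∀ c, ∑ k,
      b k * ![![1, 1, 1, 1], ![1, 1, ω, ω ^ 2], ![1, 1, ω ^ 2, ω], ![-3, 1, 0, 0]] k c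
      ∈ (algebraMap O K).range := by
    intro c
    obtain ⟨y, rfl⟩ := exists_a4Class_eq c
    simpa only [a4Eta_eq] using hb y
  have v0 := hv 0
  have v2 := hv 2
  have v3 := hv 3
  simp only [Fin.sum_univ_four, Matrix.cons_val] at v0 v2 v3
  have hω2 := pow_mem hωO 2
  have key : ∀ k, b k - b 3 ∈ (algebraMap O K).range := by
    intro k
    apply mem_range_of_three_mul_mem
    fin_cases k
    · convert! add_mem (add_mem v0 v2) v3 using 1
      simp only [Fin.reduceFinMk]
      linear_combination -(b 1 + b 2) * h0
    · convert! add_mem (add_mem v0 (mul_mem hω2 v2)) (mul_mem hωO v3) using 1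
      simp only [Fin.reduceFinMk]
      linear_combination -(b 0 + b 2) * h0 - (2 * b 1 + b 2 * ω) * h3
    · convert! add_mem (add_mem v0 (mul_mem hωO v2)) (mul_mem hω2 v3) using 1
      simp only [Fin.reduceFinMk]
      linear_combination -(b 0 + b 1) * h0 - (2 * b 2 + b 1 * ω) * h3
    · simp
  simpa using sub_mem (key k) (key l)

end Eta

/-! ### Class functions on the product -/

section Linear

variable {K P : Type*} [Field K] [CommGroup P] [Fintype P]

theorem finite_monoidHom [HasEnoughRootsOfUnity K (Monoid.exponent P)] : Finite (P →* Kˣ) :=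
  Finite.of_equiv P
    (CommGroup.monoidHom_mulEquiv_of_hasEnoughRootsOfUnity P K).some.symm.toEquiv

variable [Fintype (P →* Kˣ)]

/-- A function on `P` that vanishes outside the identity has constant Fourier coefficients. -/
theorem coeff_const_of_vanish (hX : IsIrrSystem (linChar (K := K) (P := P))) (a : (P →* Kˣ) → K)
    (h : ∀ x : P, x ≠ 1 → ∑ θ, a θ * linChar θ x = 0) (θ θ' : P →* Kˣ) : a θ = a θ' := by
  classical
  have key : ∀ θ₀, a θ₀ = (Fintype.card P : K)⁻¹ * ∑ θ, a θ := by
    intro θ₀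
    rw [← hX.charInner_sum_smul a θ₀, charInner, Finset.sum_eq_single 1]
    · simp [linChar]
    · intro x _ hx
      have := h x hx
      simp only [Finset.sum_apply, Pi.smul_apply, smul_eq_mul, this, zero_mul]
    · simp
  rw [key θ, key θ']

theorem sum_linChar_eq_zero [CharZero K] (hX : IsIrrSystem (linChar (K := K) (P := P))) {x : P}
    (hx : x ≠ 1) : ∑ θ : P →* Kˣ, linChar θ x = 0 := by
  classical
  have h := congrFun (hX.eq_sum (Pi.single 1 1) fun y g => by
    rw [mul_comm y g, mul_inv_cancel_right]) x
  have h1 : ∀ θ : P →* Kˣ, charInner (Pi.single 1 1) (linChar θ) = (Fintype.card P : K)⁻¹ := by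
    intro θ
    rw [charInner, Finset.sum_eq_single 1]
    · simp [linChar]
    · intro y _ hy
      rw [Pi.single_eq_of_ne hy, zero_mul]
    · simp
  rw [Pi.single_eq_of_ne hx] at h
  simp only [h1, Finset.sum_apply, Pi.smul_apply, smul_eq_mul, ← Finset.mul_sum] at h
  exact (mul_eq_zero.1 h.symm).resolve_left (inv_ne_zero (Nat.cast_ne_zero.2 Fintype.card_ne_zero))

end Linear

section Pair

variable {K P : Type*} [Field K] [CommGroup P]

/-- The irreducible characters `θ ⊗ χ_j` of `P × A₄`. -/
def pairChar (ω : K) (m : (P →* Kˣ) × Fin 4) : P × A4 → K :=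
  outer (linChar m.1) (a4Char ω m.2)

/-- The signed irreducible characters `θ ⊗ δ_j χ_j` of `P × A₄`. -/
def pairEta (ω : K) (m : (P →* Kˣ) × Fin 4) : P × A4 → K :=
  outer (linChar m.1) (a4Eta ω m.2)

theorem pairEta_eq_smul (ω : K) (m : (P →* Kˣ) × Fin 4) :
    pairEta ω m = (a4Sign m.2 : K) • pairChar ω m := by
  ext x
  simp only [pairEta, pairChar, outer, a4Eta, Pi.smul_apply, smul_eq_mul]
  ring

theorem a4Sign_mul_self (j : Fin 4) : a4Sign j * a4Sign j = 1 := by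
  fin_cases j <;> rfl

theorem isIrrSystem_pairChar [Fintype P] [CharZero K]
    (hX : IsIrrSystem (linChar (K := K) (P := P))) {ω : K} (hω : IsPrimitiveRoot ω 3) :
    IsIrrSystem (pairChar (P := P) ω) :=
  IsIrrSystem.prod (θ := fun θ : P →* Kˣ => (Units.coeHom K).comp θ) hX (isIrrSystem_a4Char hω)
    fun x g => by rw [mul_comm x g, mul_inv_cancel_right]

theorem a4Eta_coeff_eq_zero [CharZero K] {ω : K} (hω : IsPrimitiveRoot ω 3) (b : Fin 4 → K)
    (h : ∀ y, ∑ k, b k * a4Eta ω k y = 0) (k : Fin 4) : b k = 0 := by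
  have h1 := Fintype.linearIndependent_iff.1 (isIrrSystem_a4Char hω).linearIndependent
    (fun k => b k * a4Sign k) (by
      ext y
      simpa [a4Eta, mul_assoc] using h y) k
  refine (mul_eq_zero.1 h1).resolve_right ?_
  have h2 : (a4Sign k : K) * a4Sign k = 1 := by exact_mod_cast a4Sign_mul_self k
  exact left_ne_zero_of_mul_eq_one h2

variable [Fintype (P →* Kˣ)]

theorem sum_pairEta_apply (ω : K) (c : (P →* Kˣ) × Fin 4 → K) (x : P) (y : A4) :
    ∑ n, c n * pairEta ω n (x, y) = ∑ k, (∑ θ, c (θ, k) * linChar θ x) * a4Eta ω k y := by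
  rw [Fintype.sum_prod_type_right]
  refine Finset.sum_congr rfl fun k _ => ?_
  rw [Finset.sum_mul]
  exact Finset.sum_congr rfl fun θ _ => (mul_assoc _ _ _).symm

variable [Fintype P] [CharZero K] (hX : IsIrrSystem (linChar (K := K) (P := P))) {ω : K}
  (hω : IsPrimitiveRoot ω 3)

include hX hω in
/-- The coordinates of a function on `P × A₄` that vanishes outside `1 × A₄` do not depend on the
character of `P`. -/
theorem pair_coeff_const (c : (P →* Kˣ) × Fin 4 → K)
    (h : ∀ x y, x ≠ 1 → ∑ n, c n * pairEta ω n (x, y) = 0) (θ θ' : P →* Kˣ) (k : Fin 4) :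
    c (θ, k) = c (θ', k) := by
  refine coeff_const_of_vanish hX (fun θ => c (θ, k)) (fun x hx => ?_) θ θ'
  exact a4Eta_coeff_eq_zero hω (fun k => ∑ θ, c (θ, k) * linChar θ x)
    (fun y => by rw [← sum_pairEta_apply]; exact h x y hx) k

include hX hω in
theorem pair_coeff_sum (c : (P →* Kˣ) × Fin 4 → K)
    (h : ∀ x y, x ≠ 1 → ∑ n, c n * pairEta ω n (x, y) = 0)
    (h1 : ∀ y, a4Class y = 1 → ∑ n, c n * pairEta ω n (1, y) = 0) (θ : P →* Kˣ) :
    ∑ k, c (θ, k) = 0 := by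
  obtain ⟨y, hy⟩ := exists_a4Class_eq 1
  have h2 := h1 y hy
  rw [sum_pairEta_apply] at h2
  simp only [a4Eta_of_class_one ω _ hy, linChar, map_one, Units.val_one, mul_one,
    fun θ' k => pair_coeff_const hX hω c h θ' θ k, Finset.sum_const, ← Finset.smul_sum] at h2
  rw [nsmul_eq_mul] at h2
  have : Nonempty (P →* Kˣ) := ⟨1⟩
  exact (mul_eq_zero.1 h2).resolve_left (Nat.cast_ne_zero.2 Fintype.card_ne_zero)

end Pair

/-! ### Perfect self-isometries of the product -/

section Main

variable {O K P : Type*} [CommRing O] [Field K] [Algebra O K]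
  [CommGroup P] [Fintype P]

omit [Fintype P] in
theorem two_dvd_orderOf_iff_ne_one (hP : IsPGroup 2 P) (x : P) : 2 ∣ orderOf x ↔ x ≠ 1 := by
  obtain ⟨k, hk⟩ := IsPGroup.iff_orderOf.1 hP x
  rw [ne_eq, ← orderOf_eq_one_iff, hk]
  rcases k with _ | k
  · simp
  · simp [pow_succ]

omit [Fintype P] in
theorem two_dvd_orderOf_pair_iff (hP : IsPGroup 2 P) (x : P) (y : A4) :
    2 ∣ orderOf (x, y) ↔ x ≠ 1 ∨ a4Class y = 1 := by
  rw [Prod.orderOf_mk, Nat.prime_two.dvd_lcm, two_dvd_orderOf_iff_ne_one hP,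
    two_dvd_orderOf_iff_a4Class]

theorem linChar_mem_range [IsDomain O] [IsDiscreteValuationRing O] [IsFractionRing O K]
    (θ : P →* Kˣ) (x : P) : linChar θ x ∈ (algebraMap O K).range := by
  refine mem_range_of_pow_eq_one (n := Fintype.card P) Fintype.card_ne_zero ?_
  rw [linChar, ← Units.val_pow_eq_pow_val, ← map_pow, pow_card_eq_one, map_one, Units.val_one]

theorem exists_linChar_pow_eq_one (hP : IsPGroup 2 P) :
    ∃ n, ∀ (θ : P →* Kˣ) (x : P), linChar θ x ^ 2 ^ n = 1 := by
  obtain ⟨n, hn⟩ := IsPGroup.iff_card.1 hP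
  refine ⟨n, fun θ x => ?_⟩
  rw [linChar, ← Units.val_pow_eq_pow_val, ← map_pow, ← hn, pow_card_eq_one', map_one,
    Units.val_one]

variable [CharZero K] [Fintype (P →* Kˣ)] {ω : K}

/-- The element of `K Irr(P × A₄)` with given coordinates in the basis `θ ⊗ δ_j χ_j`. -/
noncomputable def etaComb (he : IsIrrSystem (pairChar (P := P) ω)) (a : (P →* Kˣ) × Fin 4 → K) :
    CF K (P × A4) :=
  ∑ m, (a m * a4Sign m.2) • he.cBasis m

theorem etaComb_apply (he : IsIrrSystem (pairChar (P := P) ω)) (a : (P →* Kˣ) × Fin 4 → K)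
    (g : P × A4) : (etaComb he a : P × A4 → K) g = ∑ m, a m * pairEta ω m g := by
  simp [etaComb, pairEta_eq_smul, mul_assoc]

/-- The matrix of a perfect self-isometry of `P × A₄` in the basis `θ ⊗ δ_j χ_j` is a signed
permutation matrix, and its `K`-linear extension acts accordingly. -/
theorem exists_signed_perm_eta (he : IsIrrSystem (pairChar (P := P) ω))
    {I : VChar K (P × A4) ≃ₗ[ℤ] VChar K (P × A4)} (hI : IsPerfectIsometry O 2 I) :
    ∃ (π : Equiv.Perm ((P →* Kˣ) × Fin 4)) (t : (P →* Kˣ) × Fin 4 → ℤˣ),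
      (∀ m, I (he.vBasis m) = ((t m : ℤ) * a4Sign m.2 * a4Sign (π m).2) • he.vBasis (π m)) ∧
      (∀ a, etaComb he (fun n => a (π.symm n) * (t (π.symm n) : ℤ)) ∈ CFInt O K (P × A4) ↔
        etaComb he a ∈ CFInt O K (P × A4)) ∧
      (∀ a, etaComb he (fun n => a (π.symm n) * (t (π.symm n) : ℤ)) ∈ CFIntReg O K (P × A4) 2 ↔
        etaComb he a ∈ CFIntReg O K (P × A4) 2) := by
  obtain ⟨π, s, hs⟩ := he.exists_signed_perm I hI.isometry
  obtain ⟨IK, hIK, hInt, hReg⟩ := hI.extension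
  have hsgn : ∀ j, IsUnit (a4Sign j) := fun j => IsUnit.of_mul_eq_one _ (a4Sign_mul_self j)
  let d : Fin 4 → ℤˣ := fun j => (hsgn j).unit
  have hd : ∀ j, (d j : ℤ) = a4Sign j := fun j => rfl
  have hdd : ∀ j, (a4Sign j : K) * a4Sign j = 1 := fun j => by exact_mod_cast a4Sign_mul_self j
  let t : (P →* Kˣ) × Fin 4 → ℤˣ := fun m => s m * d m.2 * d (π m).2
  have ht : ∀ m, (t m : ℤ) * a4Sign m.2 * a4Sign (π m).2 = s m := by
    intro m
    simp only [t, Units.val_mul, hd]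
    linear_combination (s m : ℤ) * (a4Sign (π m).2 * a4Sign (π m).2) * a4Sign_mul_self m.2
      + (s m : ℤ) * a4Sign_mul_self (π m).2
  have hc : ∀ m, IK (he.cBasis m) = ((s m : ℤ) : K) • he.cBasis (π m) := by
    intro m
    rw [← he.toCF_vBasis, hIK, hs, ← he.toCF_vBasis]
    ext g
    simp [VChar.toCF, zsmul_eq_mul]
  have hcomb : ∀ a, IK (etaComb he a)
      = etaComb he (fun n => a (π.symm n) * (t (π.symm n) : ℤ)) := by
    intro a
    rw [etaComb, etaComb, map_sum]
    refine (Finset.sum_congr rfl fun m _ => ?_).trans (Equiv.sum_comp π fun n =>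
      (a (π.symm n) * (t (π.symm n) : ℤ) * a4Sign n.2) • he.cBasis n)
    rw [map_smul, hc, smul_smul, Equiv.symm_apply_apply, ← ht m]
    congr 1
    push_cast
    linear_combination (a m * (t m : ℤ) * a4Sign (π m).2) * hdd m.2
  refine ⟨π, t, fun m => by rw [hs, ht], fun a => ?_, fun a => ?_⟩
  · rw [← hcomb, hInt]
  · rw [← hcomb, hReg]

/-- The permutation of the irreducible characters of `P` preserves integrality of functions: apply
the isometry to `B ⊗ χ_1`. -/
theorem integral_iff_of_perm
    (he : IsIrrSystem (pairChar (P := P) ω)) (hωO : ω ∈ (algebraMap O K).range)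
    (π : Equiv.Perm ((P →* Kˣ) × Fin 4)) (t : (P →* Kˣ) × Fin 4 → ℤˣ)
    (hInt : ∀ a, etaComb he (fun n => a (π.symm n) * (t (π.symm n) : ℤ)) ∈ CFInt O K (P × A4) ↔
        etaComb he a ∈ CFInt O K (P × A4))
    (σ : Equiv.Perm (Fin 4)) (ε : ℤˣ) (ht : ∀ m, t m = ε) (τ : Equiv.Perm (P →* Kˣ))
    (hπ : ∀ θ j, π (θ, j) = (τ θ, σ j)) (a : (P →* Kˣ) → K) :
    (∀ x, ∑ θ, a θ * linChar (τ θ) x ∈ (algebraMap O K).range) ↔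
      ∀ x, ∑ θ, a θ * linChar θ x ∈ (algebraMap O K).range := by
  classical
  obtain ⟨y₁, hy₁⟩ := exists_a4Class_eq 1
  have h := hInt fun m => if m.2 = 0 then a m.1 else 0
  have hval : ∀ x y, (etaComb he (fun m => if m.2 = 0 then a m.1 else 0) : P × A4 → K) (x, y)
      = (∑ θ, a θ * linChar θ x) * a4Eta ω 0 y := by
    intro x y
    rw [etaComb_apply, sum_pairEta_apply, Finset.sum_eq_single 0]
    · simp
    · intro k _ hk
      simp [hk]
    · simp
  have hval' : ∀ x y, (etaComb he (fun n => (if (π.symm n).2 = 0 then a (π.symm n).1 else 0) *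
      (t (π.symm n) : ℤ)) : P × A4 → K) (x, y)
      = (ε : ℤ) * ((∑ θ, a θ * linChar (τ θ) x) * a4Eta ω (σ 0) y) := by
    intro x y
    rw [etaComb_apply, ← Equiv.sum_comp π, Fintype.sum_prod_type_right, Finset.sum_eq_single 0]
    · rw [Finset.sum_mul, Finset.mul_sum]
      refine Finset.sum_congr rfl fun θ _ => ?_
      simp only [Equiv.symm_apply_apply, if_true, pairEta, outer]
      rw [ht, hπ]
      ring
    · intro k _ hk
      simp [hk]
    · simp
  have hε : ∀ b : K, (ε : ℤ) * b ∈ (algebraMap O K).range ↔ b ∈ (algebraMap O K).range := by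
    intro b
    rcases Int.units_eq_one_or ε with rfl | rfl
    · simp
    · simp [neg_mem_iff]
  constructor
  · intro hB x
    have h1 := h.1 (fun g => by
      rw [hval' g.1 g.2, hε]
      exact mul_mem (hB g.1) (a4Eta_mem_range hωO _ _)) (x, y₁)
    rwa [hval, a4Eta_of_class_one ω 0 hy₁, mul_one] at h1
  · intro hB x
    have h1 := h.2 (fun g => by
      rw [hval g.1 g.2]
      exact mul_mem (hB g.1) (a4Eta_mem_range hωO _ _)) (x, y₁)
    rwa [hval', hε, a4Eta_of_class_one ω _ hy₁, mul_one] at h1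

variable [IsDomain O] [IsDiscreteValuationRing O] [IsFractionRing O K]

/-- The elements `∑ θ, θ ⊗ (δ_i χ_i - δ_j χ_j)` are integral and vanish on the elements of even
order. -/
theorem etaComb_sub_mem_CFIntReg (hP : IsPGroup 2 P)
    (hX : IsIrrSystem (linChar (K := K) (P := P))) (he : IsIrrSystem (pairChar (P := P) ω))
    (hωO : ω ∈ (algebraMap O K).range) (i j : Fin 4) :
    etaComb he (fun n => (if n.2 = i then 1 else 0) - (if n.2 = j then 1 else 0))
      ∈ CFIntReg O K (P × A4) 2 := by
  have hval : ∀ x y, (etaComb he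
      (fun n => (if n.2 = i then 1 else 0) - (if n.2 = j then 1 else 0)) : P × A4 → K) (x, y)
      = (∑ θ : P →* Kˣ, linChar θ x) * (a4Eta ω i y - a4Eta ω j y) := by
    intro x y
    rw [etaComb_apply, sum_pairEta_apply]
    simp [sub_mul, mul_sub]
  refine ⟨fun g => ?_, fun g hg => ?_⟩
  · rw [hval g.1 g.2]
    exact mul_mem (sum_mem fun θ _ => linChar_mem_range θ _)
      (sub_mem (a4Eta_mem_range hωO _ _) (a4Eta_mem_range hωO _ _))
  · rw [hval g.1 g.2]
    rcases (two_dvd_orderOf_pair_iff hP g.1 g.2).1 hg with h | h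
    · rw [sum_linChar_eq_zero hX h, zero_mul]
    · rw [a4Eta_of_class_one ω i h, a4Eta_of_class_one ω j h, sub_self, mul_zero]

/-- The signed permutation that describes a perfect self-isometry of `P × A₄` acts on the second
factor by a permutation of the four characters, and its signs are all equal. -/
theorem exists_perm_snd (hP : IsPGroup 2 P)
    (hX : IsIrrSystem (linChar (K := K) (P := P))) (hω : IsPrimitiveRoot ω 3)
    (he : IsIrrSystem (pairChar (P := P) ω)) (hωO : ω ∈ (algebraMap O K).range)
    (π : Equiv.Perm ((P →* Kˣ) × Fin 4)) (t : (P →* Kˣ) × Fin 4 → ℤˣ)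
    (hReg : ∀ a, etaComb he (fun n => a (π.symm n) * (t (π.symm n) : ℤ))
      ∈ CFIntReg O K (P × A4) 2 ↔ etaComb he a ∈ CFIntReg O K (P × A4) 2) :
    ∃ (σ : Equiv.Perm (Fin 4)) (ε : ℤˣ), ∀ m, (π m).2 = σ m.2 ∧ t m = ε := by
  have hw := fun i j => (hReg _).2 (etaComb_sub_mem_CFIntReg hP hX he hωO i j)
  have hvan : ∀ (i j : Fin 4) (x : P) (y : A4), x ≠ 1 ∨ a4Class y = 1 → _ = (0 : K) :=
    fun i j x y h => (etaComb_apply he _ _).symm.trans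
      ((hw i j).2 (x, y) ((two_dvd_orderOf_pair_iff hP x y).2 h))
  have : Nonempty (P →* Kˣ) := ⟨1⟩
  obtain ⟨κ, ε, h⟩ := exists_perm_of_sum_zero (X := P →* Kˣ) (fun n => (π.symm n).2)
    (Prod.snd_surjective.comp π.symm.surjective) (fun n => t (π.symm n))
    (fun i j _ θ θ' k => by
      have := pair_coeff_const hX hω _ (fun x y hx => hvan i j x y (Or.inl hx)) θ θ' k
      exact_mod_cast this)
    (fun i j _ θ => by
      have := pair_coeff_sum hX hω _ (fun x y hx => hvan i j x y (Or.inl hx))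
        (fun y hy => hvan i j 1 y (Or.inr hy)) θ
      exact_mod_cast this)
  refine ⟨κ.symm, ε, fun m => ?_⟩
  have := h (π m)
  simp only [Equiv.symm_apply_apply] at this
  exact ⟨by rw [this.1, Equiv.symm_apply_apply], this.2⟩

variable [CharP (IsLocalRing.ResidueField O) 2]

/-- The permutations of the irreducible characters of `P` that a perfect self-isometry of `P × A₄`
induces above the individual characters of `A₄` are all equal: the function
`4⁻¹ ∑ j, θ ⊗ δ_j χ_j` is integral, so the images of `θ` are congruent modulo `4`. -/
theorem exists_perm_fst (hP : IsPGroup 2 P) (hω : IsPrimitiveRoot ω 3)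
    (he : IsIrrSystem (pairChar (P := P) ω)) (hωO : ω ∈ (algebraMap O K).range)
    (π : Equiv.Perm ((P →* Kˣ) × Fin 4)) (t : (P →* Kˣ) × Fin 4 → ℤˣ)
    (hInt : ∀ a, etaComb he (fun n => a (π.symm n) * (t (π.symm n) : ℤ)) ∈ CFInt O K (P × A4) ↔
        etaComb he a ∈ CFInt O K (P × A4))
    (σ : Equiv.Perm (Fin 4)) (ε : ℤˣ) (hσ : ∀ m, (π m).2 = σ m.2 ∧ t m = ε) :
    ∃ τ : Equiv.Perm (P →* Kˣ), ∀ θ j, π (θ, j) = (τ θ, σ j) := by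
  classical
  have hone := one_add_omega hω
  have key : ∀ θ i j, (π (θ, i)).1 = (π (θ, j)).1 := by
    intro θ i j
    have h4 : etaComb he (fun m => if m.1 = θ then 4⁻¹ else 0) ∈ CFInt O K (P × A4) := by
      rintro ⟨x, y⟩
      rw [etaComb_apply, sum_pairEta_apply]
      simp only [ite_mul, zero_mul, Finset.sum_ite_eq', Finset.mem_univ, if_true]
      rw [← Finset.mul_sum, sum_a4Eta hone]
      split_ifs
      · convert! linChar_mem_range (O := O) θ x using 1
        field_simp
      · rw [mul_zero]
        exact zero_mem _
    rw [← hInt] at h4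
    have hval : ∀ x y, (etaComb he (fun n => (if (π.symm n).1 = θ then 4⁻¹ else 0) *
        (t (π.symm n) : ℤ)) : P × A4 → K) (x, y)
        = ∑ k, ((ε : ℤ) * (linChar (π (θ, σ.symm k)).1 x / 4)) * a4Eta ω k y := by
      intro x y
      rw [etaComb_apply, ← Equiv.sum_comp π, Fintype.sum_prod_type_right]
      refine (Finset.sum_congr rfl fun k _ => ?_).trans (Equiv.sum_comp σ fun k =>
        ((ε : ℤ) * (linChar (π (θ, σ.symm k)).1 x / 4)) * a4Eta ω k y)
      rw [Finset.sum_eq_single θ]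
      · simp only [Equiv.symm_apply_apply, if_true, pairEta, outer, (hσ _).1, (hσ _).2]
        ring
      · intro θ' _ h
        simp [h]
      · simp
    obtain ⟨n, hn⟩ := exists_linChar_pow_eq_one (K := K) hP
    refine MonoidHom.ext fun x => Units.ext ?_
    change linChar _ x = linChar _ x
    refine eq_of_congr_four O (hn (π (θ, i)).1 x) (hn (π (θ, j)).1 x) ?_
    have h5 := sub_mem_range_of_sum_a4Eta hω hωO _ (fun y => hval x y ▸ h4 (x, y)) (σ i) (σ j)
    simp only [Equiv.symm_apply_apply, ← mul_sub] at h5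
    rcases Int.units_eq_one_or ε with rfl | rfl
    · simpa using h5
    · simpa using neg_mem h5
  have hinj : Function.Injective fun θ => (π (θ, 0)).1 := by
    intro θ θ' h
    have : π (θ, 0) = π (θ', 0) := Prod.ext h ((hσ (θ, 0)).1.trans (hσ (θ', 0)).1.symm)
    exact congrArg Prod.fst (π.injective this)
  refine ⟨Equiv.ofBijective _ (Finite.injective_iff_bijective.1 hinj), fun θ j => ?_⟩
  exact Prod.ext (key θ j 0) (hσ (θ, j)).1

end Main

/-! ### Isometries given by permutations of the irreducible characters -/

section Permutation

variable {K G ι : Type*} [Field K] [CharZero K] [Group G] [Fintype G] [Fintype ι] {e : ι → G → K}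
  (he : IsIrrSystem e)

namespace IsIrrSystem

theorem coe_eq_sum_cRepr (f : CF K G) : (f : G → K) = ∑ i, he.cBasis.repr f i • e i := by
  conv_lhs => rw [← he.cBasis.sum_repr f]
  rw [Submodule.coe_sum]
  refine Finset.sum_congr rfl fun i _ => ?_
  rw [Submodule.coe_smul, coe_cBasis]

theorem toCF_eq_sum (φ : VChar K G) :
    VChar.toCF φ = ∑ i, (he.vBasis.repr φ i : K) • he.cBasis i := by
  apply Subtype.ext
  rw [Submodule.coe_sum]
  refine (he.coe_eq_sum_repr φ).trans (Finset.sum_congr rfl fun i _ => ?_)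
  rw [Submodule.coe_smul, coe_cBasis]

/-- The isometry of `ℤ Irr(G)` that permutes the irreducible characters by `τ`. -/
noncomputable def permIso (τ : Equiv.Perm ι) : VChar K G ≃ₗ[ℤ] VChar K G :=
  he.vBasis.equiv he.vBasis τ

theorem permIso_vBasis (τ : Equiv.Perm ι) (i : ι) :
    he.permIso τ (he.vBasis i) = he.vBasis (τ i) :=
  he.vBasis.equiv_apply i he.vBasis τ

theorem repr_permIso (τ : Equiv.Perm ι) (φ : VChar K G) (i : ι) :
    he.vBasis.repr (he.permIso τ φ) i = he.vBasis.repr φ (τ.symm i) := by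
  classical
  have h : he.permIso τ φ = ∑ j, he.vBasis.repr φ j • he.vBasis (τ j) := by
    conv_lhs => rw [← he.vBasis.sum_repr φ]
    rw [map_sum]
    exact Finset.sum_congr rfl fun j _ => by rw [map_zsmul, permIso_vBasis]
  rw [h, map_sum]
  simp [Finsupp.single_apply, ← Equiv.eq_symm_apply]

theorem coe_permIso (τ : Equiv.Perm ι) (φ : VChar K G) :
    (he.permIso τ φ : G → K) = ∑ i, (he.vBasis.repr φ i : K) • e (τ i) := by
  rw [he.coe_eq_sum_repr, ← Equiv.sum_comp τ]
  simp [repr_permIso]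

theorem charInner_permIso (τ : Equiv.Perm ι) (φ ψ : VChar K G) :
    charInner (he.permIso τ φ : G → K) (he.permIso τ ψ : G → K)
      = charInner (φ : G → K) (ψ : G → K) := by
  rw [he.charInner_eq_sum_repr, he.charInner_eq_sum_repr, ← Equiv.sum_comp τ]
  simp [repr_permIso]

end IsIrrSystem

end Permutation

/-! ### Automorphisms of the group algebra of an abelian group -/

section Abelian

variable {O K P : Type*} [CommRing O] [Field K] [CharZero K] [Algebra O K]
  [CommGroup P] [Fintype P] [Fintype (P →* Kˣ)]

/-- A permutation of the irreducible characters of an abelian `2`-group that preserves integrality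
of functions is a perfect isometry: the functions that vanish outside the identity are fixed. -/
theorem isPerfectIsometry_permIso (hP : IsPGroup 2 P)
    (hX : IsIrrSystem (linChar (K := K) (P := P))) (τ : Equiv.Perm (P →* Kˣ))
    (hτ : ∀ a : (P →* Kˣ) → K, (∀ x, ∑ θ, a θ * linChar (τ θ) x ∈ (algebraMap O K).range) ↔
      ∀ x, ∑ θ, a θ * linChar θ x ∈ (algebraMap O K).range) :
    IsPerfectIsometry O 2 (hX.permIso τ) := by
  obtain ⟨IK, hb⟩ : ∃ IK : CF K P ≃ₗ[K] CF K P, ∀ θ, IK (hX.cBasis θ) = hX.cBasis (τ θ) :=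
    ⟨hX.cBasis.equiv hX.cBasis τ, fun θ => hX.cBasis.equiv_apply θ hX.cBasis τ⟩
  have h1 : ∀ (f : CF K P) (x : P),
      (f : P → K) x = ∑ θ, hX.cBasis.repr f θ * linChar θ x := by
    intro f x
    conv_lhs => rw [hX.coe_eq_sum_cRepr f]
    simp
  have h2 : ∀ (f : CF K P) (x : P),
      (IK f : P → K) x = ∑ θ, hX.cBasis.repr f θ * linChar (τ θ) x := by
    intro f x
    conv_lhs => rw [← hX.cBasis.sum_repr f, map_sum, Submodule.coe_sum, Finset.sum_apply]
    refine Finset.sum_congr rfl fun θ _ => ?_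
    rw [map_smul, hb, Submodule.coe_smul, hX.coe_cBasis, Pi.smul_apply, smul_eq_mul]
  have hInt : ∀ f : CF K P, IK f ∈ CFInt O K P ↔ f ∈ CFInt O K P := by
    intro f
    change (∀ x, _) ↔ ∀ x, _
    simp only [h1 f, h2 f]
    exact hτ _
  have hfix : ∀ f : CF K P, (∀ θ θ', hX.cBasis.repr f θ = hX.cBasis.repr f θ') → IK f = f := by
    intro f hf
    ext x
    rw [h1 f, h2 f, ← Equiv.sum_comp τ fun θ => hX.cBasis.repr f θ * linChar θ x]
    exact Finset.sum_congr rfl fun θ _ => by rw [hf θ (τ θ)]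
  refine ⟨hX.charInner_permIso τ, IK, fun φ => ?_, hInt, fun f => ⟨fun hf => ?_, fun hf => ?_⟩⟩
  · rw [hX.toCF_eq_sum φ, map_sum]
    ext x
    simp only [map_smul, hb, VChar.toCF, hX.coe_permIso]
    simp
  · have hv : ∀ x : P, x ≠ 1 →
        ∑ θ, hX.cBasis.repr f (τ.symm θ) * linChar θ x = 0 := by
      intro x hx
      rw [← hf.2 x ((two_dvd_orderOf_iff_ne_one hP x).2 hx), h2 f, ← Equiv.sum_comp τ]
      simp
    have hc := coeff_const_of_vanish hX _ hv
    rwa [hfix f fun θ θ' => by simpa using hc (τ θ) (τ θ')] at hf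
  · have hc := coeff_const_of_vanish hX _ fun x hx => by
      rw [← h1 f, hf.2 x ((two_dvd_orderOf_iff_ne_one hP x).2 hx)]
    rwa [hfix f hc]

/-- The `𝒪`-algebra homomorphism `𝒪P → K` that extends the linear character `θ`. -/
noncomputable def charEval (O : Type*) {K P : Type*} [CommRing O] [Field K] [Algebra O K]
    [CommGroup P] (θ : P →* Kˣ) : MonoidAlgebra O P →ₐ[O] K :=
  MonoidAlgebra.lift O K P ((Units.coeHom K).comp θ)

theorem evalAt_eq_sum {O K G : Type*} [CommRing O] [Field K] [Algebra O K] [Group G] [Fintype G]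
    (χ : G → K) (a : MonoidAlgebra O G) :
    evalAt χ a = ∑ h, algebraMap O K (a.coeff h) * χ h :=
  Finsupp.sum_fintype _ _ fun _ => by rw [map_zero, zero_mul]

omit [CharZero K] [Fintype P] [Fintype (P →* Kˣ)] in
theorem charEval_eq_evalAt (θ : P →* Kˣ) (a : MonoidAlgebra O P) :
    charEval O θ a = evalAt (linChar θ) a := by
  rw [charEval, MonoidAlgebra.lift_apply]
  simp only [Algebra.smul_def]
  rfl

omit [CharZero K] [Fintype P] [Fintype (P →* Kˣ)] in
theorem charEval_of (θ : P →* Kˣ) (g : P) :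
    charEval O θ (MonoidAlgebra.of O P g) = linChar θ g :=
  MonoidAlgebra.lift_of _ _

omit [CharZero K] [Fintype (P →* Kˣ)] in
theorem eq_of_charEval_eq [IsDomain O] [IsFractionRing O K]
    (hX : IsIrrSystem (linChar (K := K) (P := P))) {z w : MonoidAlgebra O P}
    (h : ∀ θ : P →* Kˣ, charEval O θ z = charEval O θ w) : z = w := by
  have h0 := hX.complete (fun x => algebraMap O K (z.coeff x⁻¹) - algebraMap O K (w.coeff x⁻¹))
    (fun x g => by rw [mul_comm x g, mul_inv_cancel_right]) fun θ => by
      have hθ := h θ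
      rw [charEval_eq_evalAt, charEval_eq_evalAt, evalAt_eq_sum, evalAt_eq_sum, ← sub_eq_zero,
        ← Finset.sum_sub_distrib, ← Equiv.sum_comp (Equiv.inv P)] at hθ
      simp only [Equiv.inv_apply, ← sub_mul] at hθ
      rw [charInner, hθ, mul_zero]
  ext x
  have := congrFun h0 x⁻¹
  simp only [inv_inv, Pi.zero_apply] at this
  exact IsFractionRing.injective O K (sub_eq_zero.1 this)

/-- A permutation `τ` of the linear characters that preserves integrality of functions comes from an
endomorphism of `𝒪P`. The image of `g` is `∑ h, τ(δ_h)(g) h`, where `δ_h` is the indicator function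
of `h`. -/
theorem exists_algHom [IsDomain O] [IsFractionRing O K]
    (hX : IsIrrSystem (linChar (K := K) (P := P))) (τ : Equiv.Perm (P →* Kˣ))
    (hτ : ∀ a : (P →* Kˣ) → K, (∀ x, ∑ θ, a θ * linChar θ x ∈ (algebraMap O K).range) →
      ∀ x, ∑ θ, a θ * linChar (τ θ) x ∈ (algebraMap O K).range) :
    ∃ α : MonoidAlgebra O P →ₐ[O] MonoidAlgebra O P,
      ∀ (θ : P →* Kˣ) z, charEval O θ (α z) = charEval O (τ θ) z := by
  classical
  have hδ : ∀ h x : P, ∑ θ : P →* Kˣ, ((Fintype.card P : K)⁻¹ * linChar θ h⁻¹) * linChar θ x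
      ∈ (algebraMap O K).range := by
    intro h x
    have h1 := congrFun (hX.eq_sum (Pi.single h 1) fun y g => by
      rw [mul_comm y g, mul_inv_cancel_right]) x
    have h2 : ∀ θ : P →* Kˣ,
        charInner (Pi.single h 1) (linChar θ) = (Fintype.card P : K)⁻¹ * linChar θ h⁻¹ := by
      intro θ
      rw [charInner, Finset.sum_eq_single h]
      · simp
      · intro y _ hy
        rw [Pi.single_eq_of_ne hy, zero_mul]
      · simp
    simp only [h2, Finset.sum_apply, Pi.smul_apply, smul_eq_mul] at h1
    rw [← h1, Pi.single_apply]
    split_ifs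
    · exact one_mem _
    · exact zero_mem _
  have hz : ∀ g : P, ∃ z : MonoidAlgebra O P,
      ∀ θ : P →* Kˣ, charEval O θ z = linChar (τ θ) g := by
    intro g
    choose r hr using fun h => hτ _ (hδ h) g
    refine ⟨.ofCoeff (Finsupp.equivFunOnFinite.symm r), fun θ => ?_⟩
    rw [charEval_eq_evalAt, evalAt_eq_sum]
    simp only [Finsupp.equivFunOnFinite_symm_apply_apply, hr, Finset.sum_mul]
    rw [Finset.sum_comm, Finset.sum_eq_single θ]
    · have := hX.inner_self θ
      rw [charInner, Finset.mul_sum] at this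
      refine Eq.trans ?_ (one_mul (linChar (τ θ) g))
      rw [← this, Finset.sum_mul]
      exact Finset.sum_congr rfl fun _ _ => by ring
    · intro θ' _ hne
      have := hX.inner_ne θ θ' hne.symm
      rw [charInner, Finset.mul_sum] at this
      refine Eq.trans ?_ (zero_mul (linChar (τ θ') g))
      rw [← this, Finset.sum_mul]
      exact Finset.sum_congr rfl fun _ _ => by ring
    · simp
  choose a ha using hz
  let a' : P →* MonoidAlgebra O P :=
    { toFun := a
      map_one' := eq_of_charEval_eq hX fun θ => by rw [ha, map_one]; simp [linChar]
      map_mul' := fun g h => eq_of_charEval_eq hX fun θ => by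
        rw [map_mul, ha, ha, ha]; simp [linChar] }
  refine ⟨MonoidAlgebra.lift O _ P a', fun θ z => ?_⟩
  have : (charEval O θ).comp (MonoidAlgebra.lift O _ P a') = charEval O (τ θ) := by
    refine (MonoidAlgebra.lift O K P).symm.injective (MonoidHom.ext fun g => ?_)
    change charEval O θ (MonoidAlgebra.lift O _ P a' (MonoidAlgebra.of O P g)) = charEval O (τ θ)
      (MonoidAlgebra.of O P g)
    rw [MonoidAlgebra.lift_of, charEval_of]
    exact ha g θ
  exact DFunLike.congr_fun this z

theorem exists_algEquiv [IsDomain O] [IsFractionRing O K]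
    (hX : IsIrrSystem (linChar (K := K) (P := P))) (τ : Equiv.Perm (P →* Kˣ))
    (hτ : ∀ a : (P →* Kˣ) → K, (∀ x, ∑ θ, a θ * linChar (τ θ) x ∈ (algebraMap O K).range) ↔
      ∀ x, ∑ θ, a θ * linChar θ x ∈ (algebraMap O K).range) :
    ∃ α : MonoidAlgebra O P ≃ₐ[O] MonoidAlgebra O P,
      ∀ (θ : P →* Kˣ) z, charEval O θ (α z) = charEval O (τ θ) z := by
  obtain ⟨α, hα⟩ := exists_algHom hX τ fun a => (hτ a).2
  obtain ⟨β, hβ⟩ := exists_algHom (O := O) hX τ.symm fun a h => by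
    intro x
    have h' := (hτ fun θ => a (τ θ)).1 (fun x => by
      rw [Equiv.sum_comp τ fun θ => a θ * linChar θ x]
      exact h x) x
    rw [← Equiv.sum_comp τ]
    simpa using h'
  refine ⟨AlgEquiv.ofAlgHom α β (AlgHom.ext fun z => ?_) (AlgHom.ext fun z => ?_), hα⟩ <;>
  exact eq_of_charEval_eq hX fun θ => by simp [hα, hβ]

theorem isInducedBy_permIso (hX : IsIrrSystem (linChar (K := K) (P := P)))
    (τ : Equiv.Perm (P →* Kˣ)) (α : MonoidAlgebra O P ≃ₐ[O] MonoidAlgebra O P)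
    (hα : ∀ (θ : P →* Kˣ) z, charEval O θ (α z) = charEval O (τ θ) z) :
    IsInducedBy α (hX.permIso τ) := by
  intro χ g
  rw [hX.coe_permIso, evalAt_eq_sum]
  conv_rhs => rw [hX.coe_eq_sum_repr χ]
  simp only [Finset.sum_apply, Pi.smul_apply, smul_eq_mul, Finset.mul_sum]
  rw [Finset.sum_comm]
  refine Finset.sum_congr rfl fun θ _ => ?_
  rw [← charEval_of (O := O), ← hα, charEval_eq_evalAt, evalAt_eq_sum, Finset.mul_sum]
  exact Finset.sum_congr rfl fun _ _ => by ring

end Abelian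

/-! ### Assembling the isometry from its factors -/

section Alternating

variable {K : Type*} [Field K] [CharZero K] {ω : K}

/-- The isometry `I_{σ,ε}` of `ℤ Irr(A₄)`. -/
theorem exists_a4Iso (hA : IsIrrSystem (a4Char ω)) (σ : Equiv.Perm (Fin 4)) (ε : ℤˣ) :
    ∃ I' : VChar K A4 ≃ₗ[ℤ] VChar K A4, ∀ j,
      I' (hA.vBasis j) = ((ε : ℤ) * a4Sign j * a4Sign (σ j)) • hA.vBasis (σ j) := by
  have hu : ∀ j, IsUnit (a4Sign j) := fun j => IsUnit.of_mul_eq_one _ (a4Sign_mul_self j)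
  refine ⟨hA.vBasis.equiv (hA.vBasis.unitsSMul fun k =>
    ε * (hu (σ.symm k)).unit * (hu k).unit) σ, fun j => ?_⟩
  rw [Module.Basis.equiv_apply, Module.Basis.unitsSMul_apply, Equiv.symm_apply_apply]
  rfl

theorem isISigma_of_vBasis (hA : IsIrrSystem (a4Char ω)) {σ : Equiv.Perm (Fin 4)} {ε : ℤˣ}
    {I' : VChar K A4 ≃ₗ[ℤ] VChar K A4}
    (h : ∀ j, I' (hA.vBasis j) = ((ε : ℤ) * a4Sign j * a4Sign (σ j)) • hA.vBasis (σ j)) :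
    IsISigma ω σ ε I' := by
  intro j
  have hj := hA.coe_vBasis j
  refine ⟨hj ▸ (hA.vBasis j).2, ?_⟩
  rw [show (⟨a4Char ω j, hj ▸ (hA.vBasis j).2⟩ : VChar K A4) = hA.vBasis j from
    Subtype.ext hj.symm, h, Submodule.coe_smul, hA.coe_vBasis]

end Alternating

section Pair

variable {K G H ι κ : Type*} [Field K] [CharZero K] [Group G] [Group H] [Fintype G] [Fintype H]
  [Fintype ι] [Fintype κ] {e : ι → G → K} {f : κ → H → K}

/-- It suffices to check `I = (J, I')` on the irreducible characters. -/
theorem isPair_of_vBasis (he : IsIrrSystem e) (hf : IsIrrSystem f)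
    (I : VChar K (G × H) ≃ₗ[ℤ] VChar K (G × H))
    (J : VChar K G ≃ₗ[ℤ] VChar K G) (I' : VChar K H ≃ₗ[ℤ] VChar K H)
    (h : ∀ i j, ∃ φ : VChar K (G × H), (φ : G × H → K) = outer (e i) (f j) ∧
      (I φ : G × H → K) = outer (J (he.vBasis i) : G → K) (I' (hf.vBasis j) : H → K)) :
    IsPair I J I' := by
  intro θ χ
  choose φ hφ hI using h
  let ψ : VChar K (G × H) := ∑ i, ∑ j, (he.vBasis.repr θ i * hf.vBasis.repr χ j) • φ i j
  have hψ : (ψ : G × H → K) = outer (θ : G → K) (χ : H → K) := by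
    ext x
    rw [outer, he.coe_eq_sum_repr θ, hf.coe_eq_sum_repr χ]
    simp only [Finset.sum_apply, Finset.sum_mul_sum, ψ, Submodule.coe_sum, Submodule.coe_smul, hφ]
    refine Finset.sum_congr rfl fun i _ => Finset.sum_congr rfl fun j _ => ?_
    simp only [Pi.smul_apply, outer, zsmul_eq_mul, smul_eq_mul]
    push_cast
    ring
  refine ⟨hψ ▸ ψ.2, ?_⟩
  rw [show (⟨outer (θ : G → K) (χ : H → K), hψ ▸ ψ.2⟩ : VChar K (G × H)) = ψ from
    Subtype.ext hψ.symm]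
  ext x
  conv_rhs => rw [← he.vBasis.sum_repr θ, ← hf.vBasis.sum_repr χ]
  simp only [outer, map_sum, map_zsmul, ψ, Submodule.coe_sum, Submodule.coe_smul, hI,
    Finset.sum_apply, Finset.sum_mul_sum]
  refine Finset.sum_congr rfl fun i _ => Finset.sum_congr rfl fun j _ => ?_
  simp only [Pi.smul_apply, outer, zsmul_eq_mul]
  push_cast
  ring

end Pair

end PerfIso

theorem theorem3p7
    {O K P : Type*}
    -- `O` is a complete discrete valuation ring with algebraically closed residue field of
    -- characteristic `2`, and `K` is its field of fractions, of characteristic zero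
    [CommRing O] [IsDomain O] [IsDiscreteValuationRing O]
    [IsAdicComplete (IsLocalRing.maximalIdeal O) O]
    [IsAlgClosed (IsLocalRing.ResidueField O)] [CharP (IsLocalRing.ResidueField O) 2]
    [Field K] [CharZero K] [Algebra O K] [IsFractionRing O K]
    -- `P` is a finite abelian `2`-group
    [CommGroup P] [Fintype P] (hP : IsPGroup 2 P)
    -- `K` contains all roots of unity of order `|P × A₄|`
    (hK : ∃ ζ : K, IsPrimitiveRoot ζ (Nat.card (P × PerfIso.A4)))
    (ω : O) (hω : IsPrimitiveRoot ω 3)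
    (I : PerfIso.VChar K (P × PerfIso.A4) ≃ₗ[ℤ] PerfIso.VChar K (P × PerfIso.A4))
    (hI : PerfIso.IsPerfectIsometry O 2 I) :
    ∃ (J : PerfIso.VChar K P ≃ₗ[ℤ] PerfIso.VChar K P)
      (I' : PerfIso.VChar K PerfIso.A4 ≃ₗ[ℤ] PerfIso.VChar K PerfIso.A4)
      (α : MonoidAlgebra O P ≃ₐ[O] MonoidAlgebra O P)
      (σ : Equiv.Perm (Fin 4)) (ε : ℤˣ),
      PerfIso.IsPerfectIsometry O 2 J ∧ PerfIso.IsInducedBy α J ∧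
      PerfIso.IsISigma (algebraMap O K ω) σ ε I' ∧
      PerfIso.IsPair I J I' := by
  open PerfIso in
  have := hasEnoughRootsOfUnity_exponent (P := P) Nat.card_pos.ne'
    (Dvd.intro _ (Nat.card_prod P A4).symm) hK
  have := finite_monoidHom (K := K) (P := P)
  have := Fintype.ofFinite (P →* Kˣ)
  have hω' : IsPrimitiveRoot (algebraMap O K ω) 3 :=
    hω.map_of_injective (IsFractionRing.injective O K)
  have hωO : algebraMap O K ω ∈ (algebraMap O K).range := ⟨ω, rfl⟩
  have hX : IsIrrSystem (linChar (K := K) (P := P)) := isIrrSystem_linChar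
  have hA := isIrrSystem_a4Char hω'
  have he := isIrrSystem_pairChar hX hω'
  obtain ⟨π, t, hIπ, hInt, hReg⟩ := exists_signed_perm_eta he hI
  obtain ⟨σ, ε, hσ⟩ := exists_perm_snd hP hX hω' he hωO π t hReg
  obtain ⟨τ, hτ⟩ := exists_perm_fst hP hω' he hωO π t hInt σ ε hσ
  have hJ := integral_iff_of_perm he hωO π t hInt σ ε (fun m => (hσ m).2) τ hτ
  obtain ⟨α, hα⟩ := exists_algEquiv hX τ hJ
  obtain ⟨I', hI'⟩ := exists_a4Iso hA σ ε
  refine ⟨hX.permIso τ, I', α, σ, ε, isPerfectIsometry_permIso hP hX τ hJ,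
    isInducedBy_permIso hX τ α hα, isISigma_of_vBasis hA hI',
    isPair_of_vBasis hX hA _ _ _ fun θ j => ⟨he.vBasis (θ, j), he.coe_vBasis _, ?_⟩⟩
  rw [hIπ, hX.permIso_vBasis, hI', (hσ _).2, hτ]
  ext x
  simp only [Submodule.coe_smul, he.coe_vBasis, hX.coe_vBasis, hA.coe_vBasis, pairChar, outer,
    Pi.smul_apply, zsmul_eq_mul]
  ring
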